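/- **Setting.** Let $M$ be an algebraically closed field with a nontrivial valuation with maximal ideal $\mathfrak m$ and residue field $k$, of characteristic $\neq 2$, regarded as a structure in the language of fields with a unary predicate for $\mathfrak m$. Assume that this structure is $\aleph_0$-saturated (as every saturated one is). For $A\subseteq M$, let $\operatorname{acl}(A)$ be the union of the finite $A$-definable subsets of $M$. An *$A$-definable $n$-curve* is a set $C\subseteq M^n$, definable with parameters in $A$, of $\operatorname{acl}$-dimension $\le 1$. Here the dimension of a set defined by a formula $\varphi$ over $B$ is the largest $d$ such that, in some elementary extension, some tuple satisfying $\varphi$ has a subtuple of length $d$ no entry of which is algebraic over $B$ and the preceding entries. An *$A$-definable curve-based cylinder* in $M^m$ is a set $\{x\in M^m : (x_{i_1},\dots,x_{i_n})\in C\}$ with $i_1<\dots<i_n$ and $C$ an $A$-definable $n$-curve, for some $n$. A structure is *geometric* if $\operatorname{acl}$ satisfies exchange ($a\in\operatorname{acl}(C\cup\{b\})\setminus\operatorname{acl}(C)$ implies $b\in\operatorname{acl}(C\cup\{a\})$) and every formula $\psi(y,\bar x)$ has a bound $N$ such that each set $\{b:\psi(b,\bar a)\}$ is infinite or has at most $N$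 elements. Let $\rho(x,y)$ be the parameter-free formula $$\exists z\,\bigl(z^2+1=0\ \wedge\ x-z\in\mathfrak m\ \wedge\ y-z\in\mathfrak m\bigr).$$ **Claim.** 1. The structure $M$ is geometric. 2. If $i\in M$ and $i^2=-1$, then $\rho(x,y)$ is equivalent in $M$ to $(x-i\in\mathfrak m\wedge y-i\in\mathfrak m)\vee(x+i\in\mathfrak m\wedge y+i\in\mathfrak m)$, and $\rho$ defines a boolean combination of $\operatorname{acl}(\emptyset)$-definable curve-based cylinders in $M^2$. 3. Suppose that the residue field $k$ has characteristic $0$ or characteristic $p\equiv 3 \pmod 4$ (equivalently, $-1$ is not a square in the prime field of $k$). Then $\rho$ does not define a boolean combination of $\emptyset$-definable curve-based cylinders. Moreover, the structure obtained by equipping the set $M$ with a predicate for each $\emptyset$-definable curve does not have quantifier elimination. Hence, in the theorem that the structure with a predicate for each $\operatorname{acl}(\emptyset)$-definable curve of a geometric structure has quantifier elimination, $\operatorname{acl}(\emptyset)$ cannot be replaced by $\emptyset$ in general. -/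

import Mathlib

open FirstOrder FirstOrder.Language Cardinal

universe u v w

/-! ## Model-theoretic notions -/

section ModelTheory

variable (L : FirstOrder.Language.{u, v}) {M : Type w} [L.Structure M]

/-- The algebraic closure of `A`: all elements of finite `A`-definable subsets of `M`. -/
def modelAcl (A : Set M) : Set M :=
  {b | ∃ s : Set M, A.Definable₁ L s ∧ s.Finite ∧ b ∈ s}

/-- `κ`-saturation: for each `A` with fewer than `κ` elements, every set of formulas in one
variable with parameters from `A` that is finitely satisfiable in `M` is realised in `M`. -/
def IsSaturatedStructure (M : Type w) [L.Structure M] (κ : Cardinal.{w}) : Prop :=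
  ∀ A : Set M, #A < κ → ∀ p : Set (L[[A]].Formula Unit),
    (∀ q : Finset (L[[A]].Formula Unit), (q : Set (L[[A]].Formula Unit)) ⊆ p →
      ∃ b : M, ∀ φ ∈ q, φ.Realize (fun _ => b)) →
    ∃ b : M, ∀ φ ∈ p, φ.Realize (fun _ => b)

/-- Geometric structures: the exchange principle and the uniform finiteness property. -/
structure IsGeometricStructure (M : Type w) [L.Structure M] : Prop where
  exchange : ∀ (a b : M) (C : Set M),
    a ∈ modelAcl L (insert b C) → a ∉ modelAcl L C → b ∈ modelAcl L (insert a C)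
  uniform_finiteness : ∀ (n : ℕ) (ψ : L.Formula (Fin n ⊕ Unit)), ∃ k : ℕ, ∀ a : Fin n → M,
    {b : M | ψ.Realize (Sum.elim a fun _ => b)}.Infinite ∨
      ({b : M | ψ.Realize (Sum.elim a fun _ => b)}.Finite ∧
        {b : M | ψ.Realize (Sum.elim a fun _ => b)}.ncard ≤ k)

/-- The acl-dimension of (the set defined by) a formula `φ` with parameters from `B ⊆ M`: the
largest `d` such that, in some elementary extension `N` of `M`, there is a tuple `a` satisfying
`φ` with a subtuple `a (j 0), …, a (j (d - 1))` in which no entry is algebraic over `B` and the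
preceding entries. It is `⊥` (that is, `-∞`) if `φ` defines the empty set. (Any type over `B`
that is realised in some elementary extension is realised in a sufficiently saturated one, so this
is the dimension computed in such an extension.) -/
noncomputable def aclDim {B : Set M} {n : ℕ} (φ : L.Formula (B ⊕ Fin n)) : WithBot ℕ∞ :=
  ⨆ (d : ℕ) (_ : ∃ (N : Type (max u v w)) (_ : L.Structure N) (f : M ↪ₑ[L] N) (a : Fin n → N)
      (j : Fin d ↪ Fin n), φ.Realize (Sum.elim (fun b => f b) a) ∧
      ∀ k : Fin d, a (j k) ∉ modelAcl L (f '' B ∪ {c | ∃ l < k, c = a (j l)})),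
    ((d : ℕ∞) : WithBot ℕ∞)

/-- `X ⊆ M ^ n` is an `A`-definable `n`-curve: it is definable with parameters from `A`, and its
dimension is at most `1`. -/
def IsCurveOver (A : Set M) {n : ℕ} (X : Set (Fin n → M)) : Prop :=
  ∃ φ : L.Formula (A ⊕ Fin n),
    X = {x | φ.Realize (Sum.elim (fun a : A => (a : M)) x)} ∧ aclDim L φ ≤ 1

/-- `Y ⊆ M ^ m` is an `A`-definable curve-based cylinder: there are indices
`i 0 < ⋯ < i (n - 1)` and an `A`-definable `n`-curve `C` such that `Y` consists of all `x` with
`(x (i 0), …, x (i (n - 1))) ∈ C`. -/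
def IsCurveBasedCylinder (A : Set M) {m : ℕ} (Y : Set (Fin m → M)) : Prop :=
  ∃ (n : ℕ) (i : Fin n ↪o Fin m) (C : Set (Fin n → M)),
    IsCurveOver L A C ∧ Y = {x | (fun k => x (i k)) ∈ C}

/-- `Y` is a (finite) boolean combination of `A`-definable curve-based cylinders. -/
def IsBoolCombOfCylinders (A : Set M) {m : ℕ} (Y : Set (Fin m → M)) : Prop :=
  Y ∈ BooleanSubalgebra.closure {Z : Set (Fin m → M) | IsCurveBasedCylinder L A Z}

/-- The relational language with one `n`-ary predicate for each `A`-definable `n`-curve. -/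
def curveLanguage (A : Set M) : FirstOrder.Language.{0, w} where
  Functions := fun _ => Empty
  Relations := fun n => {X : Set (Fin n → M) // IsCurveOver L A X}

/-- The structure on `M` with a predicate for each `A`-definable curve. -/
instance curveStructure (A : Set M) : (curveLanguage L A).Structure M where
  funMap := fun f => f.elim
  RelMap := fun R x => x ∈ R.1

/-- Quantifier elimination for (the theory of) a structure: every formula is equivalent in the
structure to a quantifier-free one in the same free variables. -/
def HasQuantifierElimination (M : Type w) [L.Structure M] : Prop :=
  ∀ (n : ℕ) (φ : L.Formula (Fin n)), ∃ ψ : L.Formula (Fin n),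
    ψ.IsQF ∧ ∀ x : Fin n → M, φ.Realize x ↔ ψ.Realize x

end ModelTheory

/-! ## Valued fields with a predicate for the maximal ideal -/

/-- The only relation symbol besides equality: a unary predicate. -/
inductive MaxIdealRel : ℕ → Type
  | mem : MaxIdealRel 1

/-- The language of fields `(+, ·, -, 0, 1)` with a unary predicate for the maximal ideal. -/
def valuedFieldLanguage : FirstOrder.Language.{0, 0} where
  Functions := FirstOrder.ringFunc
  Relations := MaxIdealRel

/-- A valued field, given by its valuation ring `𝒪`, as a structure: the function symbols are the
field operations and the predicate is the maximal ideal of `𝒪` (the elements of valuation `< 1`,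
written multiplicatively). -/
abbrev valuedFieldStructure {M : Type w} [Field M] (𝒪 : ValuationSubring M) :
    valuedFieldLanguage.Structure M where
  funMap := fun f x => (FirstOrder.Ring.compatibleRingOfRing M).toStructure.funMap f x
  RelMap := fun R => match R with
    | .mem => fun x => x 0 ∈ 𝒪.nonunits

section Terms

variable {α : Type}

/-- The term `0`. -/
def vfZero : valuedFieldLanguage.Term α := Term.func (l := 0) FirstOrder.ringFunc.zero ![]

/-- The term `1`. -/
def vfOne : valuedFieldLanguage.Term α := Term.func (l := 0) FirstOrder.ringFunc.one ![]

/-- The term `s + t`. -/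
def vfAdd (s t : valuedFieldLanguage.Term α) : valuedFieldLanguage.Term α :=
  Term.func (l := 2) FirstOrder.ringFunc.add ![s, t]

/-- The term `s * t`. -/
def vfMul (s t : valuedFieldLanguage.Term α) : valuedFieldLanguage.Term α :=
  Term.func (l := 2) FirstOrder.ringFunc.mul ![s, t]

/-- The term `s - t`, as `s + (-t)`. -/
def vfSub (s t : valuedFieldLanguage.Term α) : valuedFieldLanguage.Term α :=
  vfAdd s (Term.func (l := 1) FirstOrder.ringFunc.neg ![t])

end Terms

/-- The formula `∃ z (z² + 1 = 0 ∧ x - z ∈ 𝔪 ∧ y - z ∈ 𝔪)` in the free variables `x, y`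
(numbered `0, 1`), without parameters. -/
def rhoFormula : valuedFieldLanguage.Formula (Fin 2) :=
  let x : valuedFieldLanguage.Term (Fin 2 ⊕ Fin 1) := Term.var (Sum.inl 0)
  let y : valuedFieldLanguage.Term (Fin 2 ⊕ Fin 1) := Term.var (Sum.inl 1)
  let z : valuedFieldLanguage.Term (Fin 2 ⊕ Fin 1) := Term.var (Sum.inr 0)
  BoundedFormula.ex
    ((BoundedFormula.equal (vfAdd (vfMul z z) vfOne) vfZero ⊓
      BoundedFormula.rel (l := 1) MaxIdealRel.mem ![vfSub x z]) ⊓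
      BoundedFormula.rel (l := 1) MaxIdealRel.mem ![vfSub y z])

/-- The formula has the intended meaning. -/
theorem realize_rhoFormula {M : Type w} [Field M] (𝒪 : ValuationSubring M) (p : Fin 2 → M) :
    letI := valuedFieldStructure 𝒪
    (rhoFormula.Realize p ↔
      ∃ z : M, z ^ 2 + 1 = 0 ∧ p 0 - z ∈ 𝒪.nonunits ∧ p 1 - z ∈ 𝒪.nonunits) := by
  letI := valuedFieldStructure 𝒪
  simp only [rhoFormula, Formula.Realize, BoundedFormula.realize_ex, BoundedFormula.realize_inf,
    and_assoc]
  refine exists_congr fun z => ?_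
  have hs : ∀ (t : valuedFieldLanguage.Term (Fin 2 ⊕ Fin 1)) (e : Fin 2 ⊕ Fin 1 → M),
      (vfSub t (Term.var (Sum.inr 0))).realize e = t.realize e - e (Sum.inr 0) := by
    intro t e
    rw [sub_eq_add_neg]; rfl
  refine and_congr ?_ (and_congr ?_ ?_)
  · rw [pow_two]; exact Iff.rfl
  · show (vfSub _ _).realize _ ∈ 𝒪.nonunits ↔ _
    rw [hs]; exact Iff.rfl
  · show (vfSub _ _).realize _ ∈ 𝒪.nonunits ↔ _
    rw [hs]; exact Iff.rfl

/-! The foundation is quantifier elimination for algebraically closed valued fields, in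
back-and-forth form: two tuples at which all integral polynomials have valuations comparing in the
same way (`SameValues`) satisfy the same formulas (`realize_formula_iff`). In the extension step
saturation leaves only finitely many polynomials to match. They are split over the field generated
by the tuple; the two embeddings of the splitting field into `M` can be chosen to induce the same
valuation ring, because valuation rings with the same trace are conjugate
(`exists_comap_eq_of_comap_eq`). The value of a split polynomial at a point is governed by the
distance to a nearest root, and a matching point exists because the value group is divisible and
finitely many residue classes can always be avoided.

Consequently a point transcendental over the parameters can be moved by an infinitesimal without
changing its type, so a definable set contains a ball around each such point. Hence `modelAcl` is
field-theoretic algebraic closure, which satisfies exchange, and a definable set is infinite exactly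
when it contains a ball. The latter condition is first-order, so saturation bounds the sizes of the
finite sets in a family.

Over a square root `i` of `-1`, the formula `ρ` describes a union of two boxes whose sides are the
residue classes of `i` and `-i`, and these are one-dimensional sets over `acl(∅)`. Over `∅`, if `-1`
is not a square in the prime field of the residue field, conjugation preserves the valuation of
Gaussian integers (`valuation_add_mul_eq_sub_mul`), so `i + e` and `-i + e` have the same type for
infinitesimal `e`. Take `e₁` infinitesimal over `i` and `e₂` infinitesimal over `i, e₁`. A curve
over `∅` cannot separate `(i + e₁, i + e₂)` from `(i + e₁, -i + e₂)`: one that uses both coordinates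
would force an algebraic dependence, and one that uses a single coordinate sees only its type. But
`ρ` separates them, although it is `∃ z, R x z ∧ R y z` for a curve `R` over `∅`; this refutes
quantifier elimination. -/

/-! ### Conjugacy of valuation rings in finite normal extensions. -/

section Conjugacy

open Polynomial

/-- If `x ∈ O` is algebraic over `F`, then there is a unit `s` of `O` such that `s` and `s * x` lie in
every valuation ring that contains `O ∩ F`. -/
theorem exists_unit_mul_mem_of_isAlgebraic {F L : Type*} [Field F] [Field L] [Algebra F L]
    (O : ValuationSubring L) {x : L} (hx : x ∈ O) (halg : IsAlgebraic F x) :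
    ∃ s : L, O.valuation s = 1 ∧ ∀ W : ValuationSubring L,
      O.comap (algebraMap F L) ≤ W.comap (algebraMap F L) → s ∈ W ∧ s * x ∈ W := by
  obtain ⟨p, hp0, hpx⟩ := halg
  set v := fun c : F => O.valuation (algebraMap F L c) with hv
  -- The coefficient of largest value and, among those, of largest index. After division by it all
  -- coefficients lie in `O` and those beyond `k` have value less than one, so `s` below is `1` plus
  -- an element of the maximal ideal.
  obtain ⟨k, hk, hmax⟩ := Finset.exists_max_image p.support (fun i => toLex (v (p.coeff i), i))
    (Polynomial.support_nonempty.2 hp0)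
  have hk0 : p.coeff k ≠ 0 := Polynomial.mem_support_iff.1 hk
  have hvk : v (p.coeff k) ≠ 0 := by simp [hv, hk0]
  set a : ℕ → F := fun i => p.coeff i / p.coeff k with ha
  have ha1 : a k = 1 := div_self hk0
  have hva : ∀ i, v (a i) = v (p.coeff i) / v (p.coeff k) := fun i => by simp [ha, hv]
  have hle : ∀ i, v (a i) ≤ 1 := by
    intro i
    rw [hva, div_le_one₀ (zero_lt_iff.2 hvk)]
    by_cases hi : p.coeff i = 0
    · simp [hv, hi]
    · have := hmax i (Polynomial.mem_support_iff.2 hi)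
      rw [Prod.Lex.toLex_le_toLex] at this
      rcases this with h | h
      · exact h.le
      · exact h.1.le
  have hlt : ∀ i, k < i → v (a i) < 1 := by
    intro i hki
    rw [hva, div_lt_one₀ (zero_lt_iff.2 hvk)]
    by_cases hi : p.coeff i = 0
    · simpa [hv, hi, zero_lt_iff] using hk0
    · have := hmax i (Polynomial.mem_support_iff.2 hi)
      rw [Prod.Lex.toLex_le_toLex] at this
      rcases this with h | h
      · exact h
      · exact absurd h.2 (not_le.2 hki)
  obtain ⟨m, hm⟩ : ∃ m, p.natDegree < k + m := ⟨p.natDegree + 1, by omega⟩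
  obtain ⟨m, rfl⟩ : ∃ m', m = m' + 1 := by
    rcases m with _ | m
    · exact absurd hm (not_lt.2 (Polynomial.le_natDegree_of_ne_zero hk0))
    · exact ⟨m, rfl⟩
  set s : L := ∑ i ∈ Finset.range (m + 1), algebraMap F L (a (k + i)) * x ^ i with hs
  set t : L := ∑ i ∈ Finset.range k, algebraMap F L (a i) * x ^ i with ht
  have hst : t + s * x ^ k = 0 := by
    have h1 : ∑ i ∈ Finset.range (k + (m + 1)), algebraMap F L (a i) * x ^ i = 0 := by
      rw [Polynomial.aeval_eq_sum_range' hm] at hpx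
      have h2 : ∀ i, algebraMap F L (a i) * x ^ i =
          (algebraMap F L (p.coeff k))⁻¹ * (p.coeff i • x ^ i) := by
        intro i
        simp only [ha, map_div₀, Algebra.smul_def]
        ring
      rw [Finset.sum_congr rfl fun i _ => h2 i, ← Finset.mul_sum, hpx, mul_zero]
    rw [Finset.sum_range_add] at h1
    rw [hs, Finset.sum_mul, ← h1]
    congr 1
    exact Finset.sum_congr rfl fun i _ => by ring
  have hvx : O.valuation x ≤ 1 := (O.valuation_le_one_iff x).2 hx
  refine ⟨s, ?_, fun W hW => ?_⟩
  · rw [hs, Finset.sum_range_succ', add_zero, ha1, map_one, pow_zero, mul_one]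
    rw [add_comm]
    refine O.valuation.map_one_add_of_lt (O.valuation.map_sum_lt one_ne_zero fun i _ => ?_)
    rw [map_mul, map_pow]
    exact mul_lt_one_of_lt_of_le (hlt _ (by omega)) (pow_le_one' hvx _)
  · have haW : ∀ i, algebraMap F L (a i) ∈ W := fun i =>
      hW (show algebraMap F L (a i) ∈ O from (O.valuation_le_one_iff _).1 (hle i))
    by_cases hxW : x ∈ W
    · have : s ∈ W := sum_mem fun i _ => mul_mem (haW _) (pow_mem hxW _)
      exact ⟨this, mul_mem this hxW⟩
    · have hx0 : x ≠ 0 := by rintro rfl; exact hxW (zero_mem W)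
      have hxi : x⁻¹ ∈ W := (W.mem_or_inv_mem x).resolve_left hxW
      -- Dividing `t + s * x ^ k = 0` by `x ^ (k - 1)` writes `s * x` as a polynomial in `x⁻¹`.
      have hsx : s * x ∈ W := by
        have e : s * x = -∑ i ∈ Finset.range k, algebraMap F L (a i) * x⁻¹ ^ (k - 1 - i) := by
          have h1 : s * x = (s * x ^ k) * (x⁻¹ ^ k * x) := by
            rw [mul_assoc s, ← mul_assoc (x ^ k), ← mul_pow, mul_inv_cancel₀ hx0, one_pow, one_mul]
          rw [h1, eq_neg_of_add_eq_zero_right hst, neg_mul, ht, Finset.sum_mul]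
          congr 1
          refine Finset.sum_congr rfl fun i hi => ?_
          have hik := Finset.mem_range.1 hi
          obtain ⟨j, rfl⟩ : ∃ j, k = i + j + 1 := ⟨k - 1 - i, by omega⟩
          rw [show i + j + 1 - 1 - i = j by omega]
          rw [show x⁻¹ ^ (i + j + 1) = x⁻¹ ^ i * x⁻¹ ^ j * x⁻¹ by ring, inv_pow x i]
          field_simp
        rw [e]
        exact neg_mem (sum_mem fun i _ => mul_mem (haW _) (pow_mem hxi _))
      refine ⟨?_, hsx⟩
      have := mul_mem hsx hxi
      rwa [mul_assoc, mul_inv_cancel₀ hx0, mul_one] at this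

/-- Up to containment, valuation rings of a normal extension with the same trace are conjugate. -/
theorem exists_comap_le_of_comap_eq {F L : Type*} [Field F] [Field L] [Algebra F L]
    [FiniteDimensional F L] [Normal F L] (O₁ O₂ : ValuationSubring L)
    (h : O₁.comap (algebraMap F L) = O₂.comap (algebraMap F L)) :
    ∃ σ : L ≃ₐ[F] L, O₁.comap (σ : L →+* L) ≤ O₂ := by
  classical
  have hval : ∀ c : F, O₁.valuation (algebraMap F L c) < 1 ↔ O₂.valuation (algebraMap F L c) < 1 := by
    intro c
    rw [← ValuationSubring.mem_nonunits_iff, ← ValuationSubring.mem_nonunits_iff,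
      ValuationSubring.mem_nonunits_iff_or, ValuationSubring.mem_nonunits_iff_or, ← map_inv₀,
      ← ValuationSubring.mem_comap, ← ValuationSubring.mem_comap, h]
  -- The integral closure of the trace of `O₂`, taken as an intersection of valuation rings so that
  -- stability under automorphisms is immediate.
  set B : Subring L := ⨅ W : {W : ValuationSubring L //
    O₂.comap (algebraMap F L) ≤ W.comap (algebraMap F L)}, W.1.toSubring with hB
  have memB : ∀ x, x ∈ B ↔ ∀ W : ValuationSubring L,
      O₂.comap (algebraMap F L) ≤ W.comap (algebraMap F L) → x ∈ W := by
    intro x; simp [hB, Subring.mem_iInf]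
  have hBσ : ∀ (σ : L ≃ₐ[F] L) x, x ∈ B → σ x ∈ B := by
    intro σ x hx
    rw [memB] at hx ⊢
    intro W hW
    refine hx (W.comap (σ : L →+* L)) fun c hc => ?_
    have := hW hc
    simpa using this
  have hB2 : ∀ x ∈ B, x ∈ O₂ := fun x hx => (memB x).1 hx _ le_rfl
  have hB1 : ∀ x ∈ B, x ∈ O₁ := fun x hx => (memB x).1 hx _ h.ge
  -- the primes of `B` below the maximal ideals
  let ι (O : ValuationSubring L) (hO : ∀ x ∈ B, x ∈ O) : B →+* O :=
    (B.subtype).codRestrict O (fun x => hO x x.2)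
  let I : Ideal B := (IsLocalRing.maximalIdeal O₂).comap (ι O₂ hB2)
  let J : (L ≃ₐ[F] L) → Ideal B := fun σ =>
    (IsLocalRing.maximalIdeal O₁).comap (ι O₁ hB1 |>.comp
      (((σ : L →+* L).comp B.subtype).codRestrict B fun x => hBσ σ x x.2))
  have hI : ∀ x : B, x ∈ I ↔ O₂.valuation (x : L) < 1 := fun x => by
    rw [Ideal.mem_comap, ValuationSubring.valuation_lt_one_iff]; rfl
  have hJ : ∀ σ (x : B), x ∈ J σ ↔ O₁.valuation (σ (x : L)) < 1 := fun σ x => by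
    rw [Ideal.mem_comap, ValuationSubring.valuation_lt_one_iff]; rfl
  have hJp : ∀ σ, (J σ).IsPrime := fun σ => Ideal.comap_isPrime _ _
  -- The product of the conjugates of `x` is, up to sign, a coefficient in `F` of `O₂`-value less
  -- than one, hence of `O₁`-value less than one. So some conjugate is a nonunit of `O₁`. Prime
  -- avoidance then selects a single `σ`.
  have hcover : (I : Set B) ⊆ ⋃ σ ∈ ((Finset.univ : Finset (L ≃ₐ[F] L)) : Set _), J σ := by
    intro x hx
    have hx2 := (hI x).1 hx
    have hint : IsIntegral F (x : L) := Algebra.IsIntegral.isIntegral _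
    set P := minpoly F (x : L)
    have hsplit : (P.map (algebraMap F L)).Splits := Normal.splits' _
    have hroot : ∀ y ∈ (P.map (algebraMap F L)).roots, ∃ σ : L ≃ₐ[F] L, σ x = y := by
      intro y hy
      exact minpoly.exists_algEquiv_of_root' (Algebra.IsAlgebraic.isAlgebraic _) (by
        have := (mem_roots'.1 hy).2
        rwa [IsRoot, eval_map_algebraMap] at this)
    have hc : algebraMap F L (P.coeff 0) =
        (-1) ^ (P.map (algebraMap F L)).natDegree * (P.map (algebraMap F L)).roots.prod := by
      rw [← coeff_map]
      exact hsplit.coeff_zero_eq_prod_roots_of_monic ((minpoly.monic hint).map _)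
    have hrootB : ∀ y ∈ (P.map (algebraMap F L)).roots, y ∈ B := by
      intro y hy
      obtain ⟨σ, rfl⟩ := hroot y hy
      exact hBσ σ x x.2
    have hxr : (x : L) ∈ (P.map (algebraMap F L)).roots := by
      rw [mem_roots ((minpoly.monic hint).map _).ne_zero, IsRoot, eval_map_algebraMap]
      exact minpoly.aeval _ _
    have hc2 : O₂.valuation (algebraMap F L (P.coeff 0)) < 1 := by
      obtain ⟨R, hR⟩ := Multiset.exists_cons_of_mem hxr
      rw [hc, hR, Multiset.prod_cons, map_mul, map_mul, map_pow, Valuation.map_neg, map_one, one_pow,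
        one_mul]
      refine mul_lt_one_of_lt_of_le hx2 ((O₂.valuation_le_one_iff _).2 ?_)
      exact multiset_prod_mem _ fun y hy =>
        hB2 y (hrootB y (hR ▸ Multiset.mem_cons_of_mem hy))
    have hc1 := (hval _).2 hc2
    by_contra hcon
    have hun : ∀ y ∈ (P.map (algebraMap F L)).roots, O₁.valuation y = 1 := by
      intro y hy
      obtain ⟨σ, rfl⟩ := hroot y hy
      refine le_antisymm ((O₁.valuation_le_one_iff _).2 (hB1 _ (hrootB _ hy))) (not_lt.1 fun hl => ?_)
      exact hcon (Set.mem_biUnion (Finset.mem_coe.2 (Finset.mem_univ σ)) ((hJ σ x).2 hl))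
    rw [hc, map_mul, map_pow, Valuation.map_neg, map_one, one_pow, one_mul, map_multiset_prod,
      Multiset.prod_eq_one fun z hz => by
        obtain ⟨y, hy, rfl⟩ := Multiset.mem_map.1 hz
        exact hun y hy] at hc1
    exact lt_irrefl _ hc1
  obtain ⟨σ, -, hσ⟩ := (Ideal.subset_union_prime (R := B) 1 1 (fun σ _ _ _ => hJp σ)).1 hcover
  refine ⟨σ, fun x hx => ?_⟩
  -- The element `x` is a fraction `(s * x) / s` with both parts in `B` and `s` outside `J σ`. As `I
  -- ⊆ J σ`, `s` is also a unit of `O₂`.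
  obtain ⟨s, hs, hsW⟩ := exists_unit_mul_mem_of_isAlgebraic (F := F) (O₁.comap (σ : L →+* L)) hx (Algebra.IsAlgebraic.isAlgebraic x)
  have hcm : (O₁.comap (σ : L →+* L)).comap (algebraMap F L) = O₂.comap (algebraMap F L) := by
    rw [← h]
    ext c
    simp
  rw [hcm] at hsW
  have hsB : s ∈ B := (memB s).2 fun W hW => (hsW W hW).1
  have hs2 : ¬ O₂.valuation s < 1 := by
    intro hlt
    have h1 := (hJ σ ⟨s, hsB⟩).1 (hσ ((hI ⟨s, hsB⟩).2 hlt))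
    have hs0 : s ≠ 0 := by rintro rfl; simp at hs
    have h2 : s⁻¹ ∈ O₁.comap (σ : L →+* L) := by
      rw [← ValuationSubring.valuation_le_one_iff, map_inv₀, hs, inv_one]
    have h3 : O₁.valuation (σ s⁻¹) ≤ 1 := (O₁.valuation_le_one_iff _).2 h2
    have h4 : O₁.valuation (σ s) * O₁.valuation (σ s⁻¹) = 1 := by
      rw [← map_mul, ← map_mul, mul_inv_cancel₀ hs0, map_one, map_one]
    exact absurd h4 (mul_lt_one_of_lt_of_le h1 h3).ne
  rw [← ValuationSubring.valuation_le_one_iff]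
  have h5 : O₂.valuation (s * x) ≤ 1 := (O₂.valuation_le_one_iff _).2 (hsW O₂ le_rfl).2
  have h6 : O₂.valuation s = 1 :=
    le_antisymm ((O₂.valuation_le_one_iff _).2 (hB2 s hsB)) (not_lt.1 hs2)
  rwa [map_mul, h6, one_mul] at h5

/-- Valuation rings of a finite normal extension with the same trace are conjugate. -/
theorem exists_comap_eq_of_comap_eq {F L : Type*} [Field F] [Field L] [Algebra F L]
    [FiniteDimensional F L] [Normal F L] (O₁ O₂ : ValuationSubring L)
    (h : O₁.comap (algebraMap F L) = O₂.comap (algebraMap F L)) :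
    ∃ σ : L ≃ₐ[F] L, O₁.comap (σ : L →+* L) = O₂ := by
  obtain ⟨σ, hσ⟩ := exists_comap_le_of_comap_eq O₁ O₂ h
  obtain ⟨τ, hτ⟩ := exists_comap_le_of_comap_eq O₂ O₁ h.symm
  refine ⟨σ, le_antisymm hσ fun x hx => ?_⟩
  -- `η = σ * τ` maps `O₁.comap σ` into itself
  have h1 : ∀ y, y ∈ O₂ → (τ⁻¹ : L ≃ₐ[F] L) y ∈ O₁ := fun y hy =>
    hτ (show τ (τ⁻¹ y) ∈ O₂ by simpa using hy)
  have h2 : ∀ y, y ∈ O₁ → (σ⁻¹ : L ≃ₐ[F] L) y ∈ O₂ := fun y hy =>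
    hσ (show σ (σ⁻¹ y) ∈ O₁ by simpa using hy)
  have h3 : ∀ n : ℕ, ∀ y ∈ O₁, ((τ⁻¹ * σ⁻¹ : L ≃ₐ[F] L) ^ n) y ∈ O₁ := by
    intro n
    induction n with
    | zero => intro y hy; simpa using hy
    | succ n ih => intro y hy; rw [pow_succ']; exact h1 _ (h2 _ (ih y hy))
  -- Finite order upgrades the two inclusions to an equality: `σ` is itself a product of copies of
  -- `τ⁻¹` and `σ⁻¹`, each of which carries one ring into the other.
  have hfin : IsOfFinOrder (τ⁻¹ * σ⁻¹ : L ≃ₐ[F] L) := isOfFinOrder_of_finite _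
  obtain ⟨n, hn, hn1⟩ := hfin.exists_pow_eq_one
  have h4 := h3 (n - 1) _ (h1 _ hx)
  show σ x ∈ O₁
  have h5 : σ x = ((τ⁻¹ * σ⁻¹ : L ≃ₐ[F] L) ^ (n - 1)) (τ⁻¹ x) := by
    have : σ = (τ⁻¹ * σ⁻¹ : L ≃ₐ[F] L) ^ (n - 1) * τ⁻¹ := by
      have e : (τ⁻¹ * σ⁻¹ : L ≃ₐ[F] L) ^ (n - 1) * (τ⁻¹ * σ⁻¹) = 1 := by
        rw [← pow_succ, Nat.sub_add_cancel hn, hn1]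
      rw [← mul_assoc] at e
      exact (eq_inv_of_mul_eq_one_left e).symm ▸ by simp
    conv_lhs => rw [this]
    rfl
  rw [h5]; exact h4

end Conjugacy

/-! ### Matching a point over two embeddings of a valued field. -/

section TwoEmbeddings

open Polynomial

variable {F : Type*} [Field F] {M : Type w} [Field M] (O : ValuationSubring M)

theorem ValuationSubring.valuation_le_iff_div_mem {x y : M} (hy : y ≠ 0) :
    O.valuation x ≤ O.valuation y ↔ x / y ∈ O := by
  rw [← O.valuation_le_one_iff, map_div₀,
    div_le_one₀ (zero_lt_iff.2 ((O.valuation.ne_zero_iff).2 hy))]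

theorem ValuationSubring.comap_valuation_le_iff {O : ValuationSubring M} {j₁ j₂ : F →+* M}
    (h : O.comap j₁ = O.comap j₂) (c d : F) :
    O.valuation (j₁ c) ≤ O.valuation (j₁ d) ↔ O.valuation (j₂ c) ≤ O.valuation (j₂ d) := by
  by_cases hd : d = 0
  · simp [hd]
  · rw [O.valuation_le_iff_div_mem ((map_ne_zero j₁).2 hd),
      O.valuation_le_iff_div_mem ((map_ne_zero j₂).2 hd), ← map_div₀, ← map_div₀,
      ← ValuationSubring.mem_comap, h, ValuationSubring.mem_comap]

theorem ValuationSubring.comap_valuation_lt_iff {O : ValuationSubring M} {j₁ j₂ : F →+* M}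
    (h : O.comap j₁ = O.comap j₂) (c d : F) :
    O.valuation (j₁ c) < O.valuation (j₁ d) ↔ O.valuation (j₂ c) < O.valuation (j₂ d) := by
  rw [← not_le, ← not_le, comap_valuation_le_iff h]

theorem ValuationSubring.exists_pos_valuation_lt_one {O : ValuationSubring M} (hO : O ≠ ⊤) :
    ∃ x : M, x ≠ 0 ∧ O.valuation x < 1 := by
  by_contra! hcon
  refine hO (top_le_iff.1 fun x _ => ?_)
  by_cases hx : x = 0
  · rw [hx]; exact O.zero_mem
  · have := hcon x⁻¹ (inv_ne_zero hx)
    rw [map_inv₀, one_le_inv₀ (zero_lt_iff.2 ((O.valuation.ne_zero_iff).2 hx))] at this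
    exact (O.valuation_le_one_iff x).1 this

/-- The value of a split polynomial at a point whose distances to the roots are monomial. -/
theorem valuation_eval_eq_monomial {L : Type*} [Field L] (O : ValuationSubring M) (l : L →+* M)
    {P : L[X]} (hP : P.Splits) {b t : M} (m : L → L × ℕ)
    (hm : ∀ α ∈ P.roots, O.valuation (b - l α) = O.valuation (l (m α).1 * t ^ (m α).2)) :
    O.valuation ((P.map l).eval b) = O.valuation
      (l (P.leadingCoeff * (P.roots.map fun α => (m α).1).prod) *
        t ^ (P.roots.map fun α => (m α).2).sum) := by
  have h1 : (P.map l).eval b = l P.leadingCoeff * (P.roots.map fun α => b - l α).prod := by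
    conv_lhs => rw [hP.eq_prod_roots]
    simp [Polynomial.map_multiset_prod, eval_multiset_prod, Multiset.map_map]
  have h2 : ∀ R : Multiset L, (∀ α ∈ R,
      O.valuation (b - l α) = O.valuation (l (m α).1 * t ^ (m α).2)) →
      O.valuation (R.map fun α => b - l α).prod = O.valuation
        (l (R.map fun α => (m α).1).prod * t ^ (R.map fun α => (m α).2).sum) := by
    intro R
    induction R using Multiset.induction_on with
    | empty => simp
    | cons a R ih =>
      intro hR
      simp only [Multiset.map_cons, Multiset.prod_cons, Multiset.sum_cons, map_mul l, pow_add]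
      rw [mul_mul_mul_comm, map_mul, map_mul, hR a (Multiset.mem_cons_self a R),
        ih fun α hα => hR α (Multiset.mem_cons_of_mem hα)]
  rw [h1, map_mul, h2 _ hm, ← map_mul, map_mul l, mul_assoc]

variable [IsAlgClosed M]

/-- Two embeddings of a field into an algebraically closed valued field that induce the same
valuation ring extend to a splitting field of a polynomial, with the same property. -/
theorem exists_splitting_extension_comap_eq (j₁ j₂ : F →+* M) (h : O.comap j₁ = O.comap j₂)
    (P : F[X]) : ∃ (i : F →+* P.SplittingField) (l₁ l₂ : P.SplittingField →+* M),
      (P.map i).Splits ∧ l₁.comp i = j₁ ∧ l₂.comp i = j₂ ∧ O.comap l₁ = O.comap l₂ := by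
  have hlift : ∀ j : F →+* M, ∃ l : P.SplittingField →+* M,
      l.comp (algebraMap F P.SplittingField) = j := by
    intro j
    let := j.toAlgebra
    exact ⟨(IsAlgClosed.lift : P.SplittingField →ₐ[F] M), AlgHom.comp_algebraMap _⟩
  obtain ⟨l₁, hl₁⟩ := hlift j₁
  obtain ⟨l₂, hl₂⟩ := hlift j₂
  have : Normal F P.SplittingField := Normal.of_isSplittingField P
  -- Arbitrary extensions of `j₁` and `j₂` need not induce the same ring; conjugacy corrects the
  -- first by an automorphism.
  obtain ⟨σ, hσ⟩ := exists_comap_eq_of_comap_eq (F := F) (O.comap l₁) (O.comap l₂) (by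
    rw [ValuationSubring.comap_comap, ValuationSubring.comap_comap, hl₁, hl₂, h])
  refine ⟨algebraMap F _, l₁.comp (σ : P.SplittingField →+* P.SplittingField), l₂,
    SplittingField.splits P, ?_, hl₂, hσ⟩
  rw [← hl₁]
  ext c
  simp

/-- Values in an algebraically closed field realise the image of every finite cut. -/
theorem exists_same_cut {L : Type*} [Field L] {O : ValuationSubring M} (hO : O ≠ ⊤)
    {l₁ l₂ : L →+* M} (h : O.comap l₁ = O.comap l₂) (W : Finset L) {g : M} (hg : g ≠ 0) :
    ∃ g' : M, g' ≠ 0 ∧ ∀ e ∈ W,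
      (O.valuation g < O.valuation (l₁ e) ↔ O.valuation g' < O.valuation (l₂ e)) ∧
      (O.valuation (l₁ e) < O.valuation g ↔ O.valuation (l₂ e) < O.valuation g') := by
  classical
  set v := O.valuation
  have hle := ValuationSubring.comap_valuation_le_iff h
  have hlt := ValuationSubring.comap_valuation_lt_iff h
  by_cases hex : ∃ e ∈ W, v (l₁ e) = v g
  · obtain ⟨e, heW, he⟩ := hex
    have he0 : e ≠ 0 := by
      rintro rfl
      rw [map_zero, map_zero] at he
      exact hg ((map_eq_zero v).1 he.symm)
    refine ⟨l₂ e, (map_ne_zero l₂).2 he0, fun f _ => ?_⟩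
    rw [← he, hlt, hlt]
    exact ⟨Iff.rfl, Iff.rfl⟩
  push Not at hex
  obtain ⟨π, hπ0, hπ⟩ := ValuationSubring.exists_pos_valuation_lt_one hO
  have hpos : ∀ {x : M}, x ≠ 0 → 0 < v x := fun hx => zero_lt_iff.2 (v.ne_zero_iff.2 hx)
  -- it is enough to separate the elements below from those above
  suffices hsep : ∃ g' : M, g' ≠ 0 ∧ (∀ e ∈ W, v (l₁ e) < v g → v (l₂ e) < v g') ∧
      ∀ e ∈ W, v g < v (l₁ e) → v g' < v (l₂ e) by
    obtain ⟨g', hg', hlo, hhi⟩ := hsep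
    refine ⟨g', hg', fun e he => ?_⟩
    rcases lt_or_gt_of_ne (hex e he) with h1 | h1
    · have := hlo e he h1
      exact ⟨iff_of_false h1.not_gt this.not_gt, iff_of_true h1 this⟩
    · have := hhi e he h1
      exact ⟨iff_of_true h1 this, iff_of_false h1.not_gt this.not_gt⟩
  -- Inserting `0` makes `lo` nonempty; `a = 0` then means that there is no effective lower bound.
  set lo := insert 0 (W.filter fun e => v (l₁ e) < v g)
  set hi := W.filter fun e => v g < v (l₁ e)
  obtain ⟨a, ha, hamax⟩ := Finset.exists_max_image lo (fun e => v (l₁ e)) ⟨0, Finset.mem_insert_self _ _⟩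
  have hag : v (l₁ a) < v g := by
    rcases Finset.mem_insert.1 ha with rfl | ha
    · simpa using hpos hg
    · exact (Finset.mem_filter.1 ha).2
  have hamax' : ∀ e ∈ W, v (l₁ e) < v g → v (l₂ e) ≤ v (l₂ a) := fun e he hlt' =>
    (hle _ _).1 (hamax e (Finset.mem_insert_of_mem (Finset.mem_filter.2 ⟨he, hlt'⟩)))
  by_cases hhi : hi.Nonempty
  · obtain ⟨b, hb, hbmin⟩ := Finset.exists_min_image hi (fun e => v (l₁ e)) hhi
    have hab : v (l₂ a) < v (l₂ b) := (hlt _ _).1 (hag.trans (Finset.mem_filter.1 hb).2)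
    have hbmin' : ∀ e ∈ W, v g < v (l₁ e) → v (l₂ b) ≤ v (l₂ e) := fun e he hlt' =>
      (hle _ _).1 (hbmin e (Finset.mem_filter.2 ⟨he, hlt'⟩))
    have hb0 : l₂ b ≠ 0 := by
      intro hb0
      rw [hb0, map_zero] at hab
      exact not_lt_zero hab
    suffices hmid : ∃ g' : M, v (l₂ a) < v g' ∧ v g' < v (l₂ b) by
      obtain ⟨g', h1, h2⟩ := hmid
      refine ⟨g', ?_, fun e he h' => (hamax' e he h').trans_lt h1,
        fun e he h' => h2.trans_le (hbmin' e he h')⟩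
      rintro rfl
      rw [map_zero] at h1
      exact not_lt_zero h1
    by_cases ha0 : l₂ a = 0
    · refine ⟨l₂ b * π, ?_, ?_⟩
      · rw [ha0, map_zero]
        exact hpos (mul_ne_zero hb0 hπ0)
      · rw [map_mul]
        exact mul_lt_of_lt_one_right (hpos hb0) hπ
    · obtain ⟨z, hz⟩ := IsAlgClosed.exists_pow_nat_eq (l₂ a * l₂ b) (n := 2) two_pos
      have hz' : v z * v z = v (l₂ a) * v (l₂ b) := by rw [← map_mul, ← map_mul, ← hz, sq]
      refine ⟨z, lt_of_not_ge fun hc => ?_, lt_of_not_ge fun hc => ?_⟩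
      · exact hz'.not_lt ((mul_le_mul_left hc _).trans_lt
          (mul_lt_mul_of_pos_left (hc.trans_lt hab) (hpos ha0)))
      · exact hz'.not_gt ((mul_le_mul_right hc _).trans_lt
          (mul_lt_mul_of_pos_right (hab.trans_le hc) ((hpos hb0).trans_le hc)))
  · refine ⟨if l₂ a = 0 then 1 else l₂ a / π, ?_, fun e he h' => (hamax' e he h').trans_lt ?_, ?_⟩
    · split_ifs with h0
      · exact one_ne_zero
      · exact div_ne_zero h0 hπ0
    · split_ifs with h0
      · simp [h0]
      · rw [map_div₀, lt_div_iff₀ (hpos hπ0)]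
        exact mul_lt_of_lt_one_right (hpos h0) hπ
    · intro e he h'
      exact absurd ⟨e, Finset.mem_filter.2 ⟨he, h'⟩⟩ hhi

/-- A version of `exists_same_cut` for finitely many monomials. -/
theorem exists_same_monomial_comparisons {L : Type*} [Field L] {O : ValuationSubring M} (hO : O ≠ ⊤)
    {l₁ l₂ : L →+* M} (h : O.comap l₁ = O.comap l₂) (U : Finset (L × ℕ)) {g : M} (hg : g ≠ 0) :
    ∃ g' : M, g' ≠ 0 ∧ ∀ p ∈ U, ∀ q ∈ U,
      (O.valuation (l₁ p.1 * g ^ p.2) < O.valuation (l₁ q.1 * g ^ q.2) ↔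
        O.valuation (l₂ p.1 * g' ^ p.2) < O.valuation (l₂ q.1 * g' ^ q.2)) := by
  classical
  -- Comparing two monomials in `t` amounts to comparing `t ^ k` with a constant, where `k` is the
  -- difference of the exponents. Raising to the power `N / k` turns all these comparisons into one
  -- cut for `t ^ N`.
  obtain ⟨N, hN0, hN⟩ : ∃ N : ℕ, 0 < N ∧ ∀ p ∈ U, ∀ k, 0 < k → k ≤ p.2 → k ∣ N :=
    ⟨(U.sup Prod.snd).factorial, Nat.factorial_pos _, fun p hp k hk hkp =>
      Nat.dvd_factorial hk (hkp.trans (Finset.le_sup (f := Prod.snd) hp))⟩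
  set W : Finset L := (U ×ˢ U).image fun pq => (pq.2.1 / pq.1.1) ^ (N / (pq.1.2 - pq.2.2))
  obtain ⟨h', hh'0, hh'⟩ := exists_same_cut hO h W (pow_ne_zero N hg)
  obtain ⟨g', rfl⟩ := IsAlgClosed.exists_pow_nat_eq h' hN0
  have hg' : g' ≠ 0 := by rintro rfl; exact hh'0 (zero_pow hN0.ne')
  refine ⟨g', hg', ?_⟩
  have hpos : ∀ {x : M}, x ≠ 0 → 0 < O.valuation x :=
    fun hx => zero_lt_iff.2 (O.valuation.ne_zero_iff.2 hx)
  -- comparison with the smaller exponent cancelled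
  have key : ∀ p ∈ U, ∀ q ∈ U, q.2 < p.2 → p.1 ≠ 0 →
      (O.valuation (l₁ p.1 * g ^ p.2) < O.valuation (l₁ q.1 * g ^ q.2) ↔
        O.valuation (l₂ p.1 * g' ^ p.2) < O.valuation (l₂ q.1 * g' ^ q.2)) ∧
      (O.valuation (l₁ q.1 * g ^ q.2) < O.valuation (l₁ p.1 * g ^ p.2) ↔
        O.valuation (l₂ q.1 * g' ^ q.2) < O.valuation (l₂ p.1 * g' ^ p.2)) := by
    intro p hp q hq hlt hp0
    obtain ⟨n, hn⟩ := hN p hp (p.2 - q.2) (by omega) (by omega)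
    have hk : 0 < p.2 - q.2 := by omega
    have hn0 : n ≠ 0 := by rintro rfl; omega
    have hW : (q.1 / p.1) ^ n ∈ W := Finset.mem_image.2 ⟨(p, q), Finset.mem_product.2 ⟨hp, hq⟩, by
      simp only
      rw [hn, Nat.mul_div_cancel_left _ hk]⟩
    have hcut := hh' _ hW
    have red : ∀ (l : L →+* M) (t : M), t ≠ 0 →
        (O.valuation (l p.1 * t ^ p.2) < O.valuation (l q.1 * t ^ q.2) ↔
          O.valuation (t ^ N) < O.valuation (l ((q.1 / p.1) ^ n))) ∧
        (O.valuation (l q.1 * t ^ q.2) < O.valuation (l p.1 * t ^ p.2) ↔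
          O.valuation (l ((q.1 / p.1) ^ n)) < O.valuation (t ^ N)) := by
      intro l t ht
      have hlp : l p.1 ≠ 0 := (map_ne_zero l).2 hp0
      have e1 : O.valuation (l p.1 * t ^ p.2) =
          O.valuation (t ^ (p.2 - q.2)) * O.valuation (l p.1 * t ^ q.2) := by
        rw [← map_mul]; congr 1
        rw [mul_left_comm, ← pow_add, Nat.sub_add_cancel hlt.le]
      have e2 : O.valuation (l q.1 * t ^ q.2) =
          O.valuation (l (q.1 / p.1)) * O.valuation (l p.1 * t ^ q.2) := by
        rw [← map_mul, map_div₀]; congr 1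
        field_simp
      have hz : 0 < O.valuation (l p.1 * t ^ q.2) := hpos (mul_ne_zero hlp (pow_ne_zero _ ht))
      rw [e1, e2, mul_lt_mul_iff_left₀ hz, mul_lt_mul_iff_left₀ hz, hn, pow_mul, map_pow l,
        map_pow _ _ n, map_pow _ _ n, pow_lt_pow_iff_left₀ zero_le zero_le hn0,
        pow_lt_pow_iff_left₀ zero_le zero_le hn0]
      exact ⟨Iff.rfl, Iff.rfl⟩
    rw [(red l₁ g hg).1, (red l₁ g hg).2, (red l₂ g' hg').1, (red l₂ g' hg').2]
    exact hcut
  intro p hp q hq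
  by_cases hp0 : p.1 = 0
  · by_cases hq0 : q.1 = 0
    · simp [hp0, hq0]
    · simp only [hp0, map_zero, zero_mul]
      exact iff_of_true (hpos (mul_ne_zero ((map_ne_zero l₁).2 hq0) (pow_ne_zero _ hg)))
        (hpos (mul_ne_zero ((map_ne_zero l₂).2 hq0) (pow_ne_zero _ hg')))
  by_cases hq0 : q.1 = 0
  · simp [hq0]
  rcases lt_trichotomy p.2 q.2 with hlt | heq | hlt
  · exact (key q hq p hp hlt hq0).2
  · rw [heq, map_mul, map_mul, map_mul, map_mul, mul_lt_mul_iff_left₀ (hpos (pow_ne_zero _ hg)),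
      mul_lt_mul_iff_left₀ (hpos (pow_ne_zero _ hg'))]
    exact ValuationSubring.comap_valuation_lt_iff h _ _
  · exact (key p hp q hq hlt hp0).1

/-- In every sphere around `0` there is a point that avoids finitely many residue classes. -/
theorem exists_valuation_eq_sub_eq_max (O : ValuationSubring M) (T : Finset M) {g : M} (hg : g ≠ 0) :
    ∃ x : M, O.valuation x = O.valuation g ∧
      ∀ t ∈ T, O.valuation (x - t) = max (O.valuation g) (O.valuation t) := by
  classical
  set v := O.valuation
  -- Only the points of value `v g` can come too close, and scaling by `g` makes them integral. A
  -- solution `u` of `∏ (u - τ) = 1` lies in none of their residue classes: the factors have value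
  -- at most one and product one.
  set T' := insert 0 ((T.filter fun t => v t = v g).image fun t => t / g)
  have hg0 : v g ≠ 0 := v.ne_zero_iff.2 hg
  have hT' : ∀ τ ∈ T', v τ ≤ 1 := by
    intro τ hτ
    rcases Finset.mem_insert.1 hτ with rfl | hτ
    · simp
    · obtain ⟨t, ht, rfl⟩ := Finset.mem_image.1 hτ
      rw [map_div₀, (Finset.mem_filter.1 ht).2, div_self hg0]
  set P : M[X] := ∏ τ ∈ T', (X - C τ)
  have hP : P.Monic := monic_prod_of_monic _ _ fun τ _ => monic_X_sub_C τ
  have hdeg : 0 < P.degree := by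
    rw [degree_prod_of_monic _ _ fun τ _ => monic_X_sub_C τ]
    simp [T']
  obtain ⟨u, hu⟩ := IsAlgClosed.exists_root (P - C 1) (by
    rw [degree_sub_C hdeg]; exact hdeg.ne')
  have hu1 : ∏ τ ∈ T', v (u - τ) = 1 := by
    have : P.eval u = 1 := by simpa [sub_eq_zero] using hu
    rw [← map_prod, ← map_one v, ← this, eval_prod]
    simp
  have hule : v u ≤ 1 := by
    by_contra! hlt
    have : ∀ τ ∈ T', 1 < v (u - τ) := fun τ hτ => by
      rwa [v.map_sub_eq_of_lt_left ((hT' τ hτ).trans_lt hlt)]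
    have h0 : 1 < ∏ τ ∈ T', v (u - τ) := by
      rw [← Finset.mul_prod_erase _ _ (Finset.mem_insert_self 0 _)]
      refine lt_of_lt_of_le (this 0 (Finset.mem_insert_self _ _)) (le_mul_of_one_le_right' ?_)
      exact Finset.one_le_prod' fun τ hτ => (this τ (Finset.mem_of_mem_erase hτ)).le
    exact h0.ne' hu1
  have hall : ∀ τ ∈ T', v (u - τ) = 1 := by
    have hle : ∀ τ ∈ T', v (u - τ) ≤ 1 := fun τ hτ => v.map_sub_le hule (hT' τ hτ)
    intro τ hτ
    refine le_antisymm (hle τ hτ) ?_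
    rw [← hu1, ← Finset.mul_prod_erase _ _ hτ]
    exact mul_le_of_le_one_right' (Finset.prod_le_one' fun τ hτ => hle τ (Finset.mem_of_mem_erase hτ))
  have hvu : v u = 1 := by simpa using hall 0 (Finset.mem_insert_self _ _)
  refine ⟨g * u, by rw [map_mul, hvu, mul_one], fun t ht => ?_⟩
  by_cases htg : v t = v g
  · have := hall (t / g) (Finset.mem_insert_of_mem
      (Finset.mem_image_of_mem _ (Finset.mem_filter.2 ⟨ht, htg⟩)))
    rw [htg, max_self, show g * u - t = g * (u - t / g) by field_simp, map_mul, this, mul_one]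
  · have hgu : v (g * u) = v g := by rw [map_mul, hvu, mul_one]
    rw [sub_eq_add_neg, v.map_add_of_distinct_val (by rw [v.map_neg, hgu]; exact fun e => htg e.symm),
      v.map_neg, hgu]

/-- Realising a finite amount of the quantifier-free type of a point over a valued field. -/
theorem exists_same_polynomial_comparisons {L : Type*} [Field L] {O : ValuationSubring M}
    (hO : O ≠ ⊤) {l₁ l₂ : L →+* M} (h : O.comap l₁ = O.comap l₂) (S : Finset L[X])
    (hS : ∀ P ∈ S, P.Splits) (b : M) :
    ∃ b' : M, ∀ P ∈ S, ∀ Q ∈ S,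
      (O.valuation ((P.map l₁).eval b) < O.valuation ((Q.map l₁).eval b) ↔
        O.valuation ((P.map l₂).eval b') < O.valuation ((Q.map l₂).eval b')) := by
  classical
  by_cases hb : ∃ α, l₁ α = b
  · obtain ⟨α, rfl⟩ := hb
    refine ⟨l₂ α, fun P _ Q _ => ?_⟩
    rw [eval_map_apply, eval_map_apply, eval_map_apply, eval_map_apply]
    exact ValuationSubring.comap_valuation_lt_iff h _ _
  push Not at hb
  set v := O.valuation
  set T : Finset L := insert 0 (S.biUnion fun P => P.roots.toFinset)
  -- Since `α₀` is nearest to `b`, the ultrametric inequality makes `v (b - l₁ α)` the larger of `v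
  -- g` and `v (l₁ (α - α₀))`; the value of each polynomial at `b` is therefore that of a monomial
  -- in `g`.
  obtain ⟨α₀, -, hmin⟩ := Finset.exists_min_image T (fun α => v (b - l₁ α))
    ⟨0, Finset.mem_insert_self _ _⟩
  set g := b - l₁ α₀ with hgdef
  have hg : g ≠ 0 := sub_ne_zero.2 (hb α₀).symm
  have hdist : ∀ α ∈ T, v (b - l₁ α) = max (v g) (v (l₁ (α - α₀))) := by
    intro α hα
    have e : b - l₁ α = g - l₁ (α - α₀) := by rw [map_sub, hgdef]; ring
    refine le_antisymm (e ▸ v.map_sub _ _) (max_le (hmin α hα) ?_)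
    have e' : l₁ (α - α₀) = g - (b - l₁ α) := by rw [e]; ring
    rw [e']
    exact v.map_sub_le (hmin α hα) le_rfl
  set m : L → L × ℕ := fun α => if v g < v (l₁ (α - α₀)) then (α - α₀, 0) else (1, 1) with hm
  set c : L[X] → L × ℕ := fun P => (P.leadingCoeff * (P.roots.map fun α => (m α).1).prod,
    (P.roots.map fun α => (m α).2).sum)
  -- Besides the monomials of the polynomials, `g` is compared with each `α - α₀`, so that the same
  -- branch of `m` applies on the other side.
  obtain ⟨g', hg', hcmp⟩ := exists_same_monomial_comparisons hO h
    (S.image c ∪ (T.image (fun α => (α - α₀, 0)) ∪ {(1, 1)})) hg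
  obtain ⟨x, hx, hxT⟩ := exists_valuation_eq_sub_eq_max O (T.image fun α => l₂ (α - α₀)) hg'
  have hroot : ∀ P ∈ S, ∀ α ∈ P.roots, α ∈ T := fun P hP α hα =>
    Finset.mem_insert_of_mem (Finset.mem_biUnion.2 ⟨P, hP, Multiset.mem_toFinset.2 hα⟩)
  have e1 : ∀ P ∈ S, v ((P.map l₁).eval b) = v (l₁ (c P).1 * g ^ (c P).2) := by
    intro P hP
    refine valuation_eval_eq_monomial O l₁ (hS P hP) m fun α hα => ?_
    rw [hdist α (hroot P hP α hα)]
    simp only [hm]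
    split_ifs with hlt
    · rw [max_eq_right hlt.le]; simp [v]
    · rw [max_eq_left (not_lt.1 hlt)]; simp [v]
  have e2 : ∀ P ∈ S, v ((P.map l₂).eval (l₂ α₀ + x)) = v (l₂ (c P).1 * g' ^ (c P).2) := by
    intro P hP
    refine valuation_eval_eq_monomial O l₂ (hS P hP) m fun α hα => ?_
    have hαT := hroot P hP α hα
    have h1 := hxT _ (Finset.mem_image_of_mem _ hαT)
    have h2 := hcmp (1, 1) (by simp) (α - α₀, 0) (by
      simp only [Finset.mem_union, Finset.mem_image]
      exact Or.inr (Or.inl ⟨α, hαT, rfl⟩))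
    simp only [map_one, pow_one, one_mul, pow_zero, mul_one] at h2
    rw [show l₂ α₀ + x - l₂ α = x - l₂ (α - α₀) by rw [map_sub]; ring, h1]
    simp only [hm, v, h2]
    split_ifs with hlt
    · rw [max_eq_right hlt.le]; simp
    · rw [max_eq_left (not_lt.1 hlt)]; simp
  refine ⟨l₂ α₀ + x, fun P hP Q hQ => ?_⟩
  rw [e1 P hP, e1 Q hQ, e2 P hP, e2 Q hQ]
  exact hcmp _ (Finset.mem_union_left _ (Finset.mem_image_of_mem c hP)) _
    (Finset.mem_union_left _ (Finset.mem_image_of_mem c hQ))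

end TwoEmbeddings

/-! ### Saturation for formulas with a finite tuple of parameters. -/

section Saturation

variable {L : FirstOrder.Language.{u, v}} {M : Type w} [L.Structure M]

/-- Saturation over finite sets, for formulas whose parameters are a finite tuple. -/
theorem IsSaturatedStructure.exists_realize (hM : IsSaturatedStructure L M ℵ₀) {α : Type*}
    [Finite α] (a : α → M) (Γ : Set (L.Formula (α ⊕ Unit)))
    (hΓ : ∀ q : Finset (L.Formula (α ⊕ Unit)), (q : Set (L.Formula (α ⊕ Unit))) ⊆ Γ →
      ∃ b : M, ∀ φ ∈ q, φ.Realize (Sum.elim a fun _ => b)) :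
    ∃ b : M, ∀ φ ∈ Γ, φ.Realize (Sum.elim a fun _ => b) := by
  classical
  set A : Set M := Set.range a
  let e : L.Formula (α ⊕ Unit) → L[[A]].Formula Unit := fun φ =>
    BoundedFormula.constantsVarsEquiv.symm
      (φ.relabel (Sum.map (fun i => (⟨a i, i, rfl⟩ : A)) id) : L.Formula (A ⊕ Unit))
  have he : ∀ φ b, (e φ).Realize (fun _ => b) ↔ φ.Realize (Sum.elim a fun _ => b) := by
    intro φ b
    have h1 : ∀ ψ : L[[A]].Formula Unit, ψ.Realize (fun _ => b) ↔
        Formula.Realize (BoundedFormula.constantsVarsEquiv ψ : L.Formula (A ⊕ Unit))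
          (Sum.elim (fun x : A => (x : M)) fun _ => b) := by
      intro ψ
      refine (BoundedFormula.realize_constantsVarsEquiv (φ := ψ)).symm
    rw [h1]
    simp only [e, Equiv.apply_symm_apply, Formula.realize_relabel]
    rw [Sum.elim_comp_map]
    rfl
  obtain ⟨b, hb⟩ := hM A (by
    rw [Cardinal.lt_aleph0_iff_finite]
    exact Set.finite_range a) (e '' Γ) (by
    intro q hq
    obtain ⟨q', hq', rfl⟩ := Finset.subset_set_image_iff.1 hq
    obtain ⟨b, hb⟩ := hΓ q' hq'
    refine ⟨b, fun φ hφ => ?_⟩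
    obtain ⟨ψ, hψ, rfl⟩ := Finset.mem_image.1 hφ
    exact (he ψ b).2 (hb ψ hψ))
  exact ⟨b, fun φ hφ => (he φ b).1 (hb _ (Set.mem_image_of_mem e hφ))⟩

end Saturation

/-! ### Terms and valuation comparisons in the language of valued fields. -/

section Interpretation

variable {M : Type w} [Field M]

/-- The symbols of the language of valued fields are interpreted by the field operations and the
maximal ideal of `O`. -/
structure InterpretsValuedField (O : ValuationSubring M) [valuedFieldLanguage.Structure M] :
    Prop where
  add : ∀ x : Fin 2 → M,
    Structure.funMap (L := valuedFieldLanguage) (n := 2) ringFunc.add x = x 0 + x 1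
  mul : ∀ x : Fin 2 → M,
    Structure.funMap (L := valuedFieldLanguage) (n := 2) ringFunc.mul x = x 0 * x 1
  neg : ∀ x : Fin 1 → M,
    Structure.funMap (L := valuedFieldLanguage) (n := 1) ringFunc.neg x = -x 0
  zero : ∀ x : Fin 0 → M,
    Structure.funMap (L := valuedFieldLanguage) (n := 0) ringFunc.zero x = 0
  one : ∀ x : Fin 0 → M,
    Structure.funMap (L := valuedFieldLanguage) (n := 0) ringFunc.one x = 1
  mem : ∀ x : Fin 1 → M,
    Structure.RelMap (L := valuedFieldLanguage) (n := 1) MaxIdealRel.mem x ↔ O.valuation (x 0) < 1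

theorem interpretsValuedField_valuedFieldStructure (O : ValuationSubring M) :
    @InterpretsValuedField M _ O (valuedFieldStructure O) :=
  @InterpretsValuedField.mk M _ O (valuedFieldStructure O) (fun _ => rfl) (fun _ => rfl)
    (fun _ => rfl) (fun _ => rfl) (fun _ => rfl) (fun _ => O.mem_nonunits_iff)

variable {α : Type*}

/-- The product of two terms. -/
def mulTerm (s t : valuedFieldLanguage.Term α) : valuedFieldLanguage.Term α :=
  Functions.apply₂ (L := valuedFieldLanguage) ringFunc.mul s t

/-- The sum of two terms. -/
def addTerm (s t : valuedFieldLanguage.Term α) : valuedFieldLanguage.Term α :=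
  Functions.apply₂ (L := valuedFieldLanguage) ringFunc.add s t

/-- The opposite of a term. -/
def negTerm (s : valuedFieldLanguage.Term α) : valuedFieldLanguage.Term α :=
  Functions.apply₁ (L := valuedFieldLanguage) ringFunc.neg s

/-- The term `0`. -/
def zeroTerm : valuedFieldLanguage.Term α :=
  Term.func (L := valuedFieldLanguage) (l := 0) ringFunc.zero ![]

/-- The term `1`. -/
def oneTerm : valuedFieldLanguage.Term α :=
  Term.func (L := valuedFieldLanguage) (l := 0) ringFunc.one ![]

/-- The formula saying that the value of `s` is smaller than the value of `t`. -/
def valuationLT (s t : valuedFieldLanguage.Term α) : valuedFieldLanguage.Formula α :=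
  BoundedFormula.ex (n := 0)
    ((BoundedFormula.rel (l := 1) MaxIdealRel.mem ![Term.var (Sum.inr 0)] ⊓
      BoundedFormula.equal (s.relabel Sum.inl)
        (mulTerm (t.relabel Sum.inl) (Term.var (Sum.inr 0)))) ⊓
      -- For `s = t = 0` the equation is solvable but the inequality is not strict.
      ∼(BoundedFormula.equal (t.relabel Sum.inl) zeroTerm))

variable {O : ValuationSubring M} [valuedFieldLanguage.Structure M]

namespace InterpretsValuedField

theorem realize_mul (hM : InterpretsValuedField O) (s t : valuedFieldLanguage.Term α) (v : α → M) :
    (mulTerm s t).realize v = s.realize v * t.realize v := by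
  exact Term.realize_functions_apply₂.trans (hM.mul _)

theorem realize_add (hM : InterpretsValuedField O) (s t : valuedFieldLanguage.Term α) (v : α → M) :
    (addTerm s t).realize v = s.realize v + t.realize v := by
  exact Term.realize_functions_apply₂.trans (hM.add _)

theorem realize_neg (hM : InterpretsValuedField O) (s : valuedFieldLanguage.Term α) (v : α → M) :
    (negTerm s).realize v = -s.realize v := by
  exact Term.realize_functions_apply₁.trans (hM.neg _)

theorem realize_zero (hM : InterpretsValuedField O) (v : α → M) :
    (zeroTerm : valuedFieldLanguage.Term α).realize v = 0 :=
  hM.zero _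

theorem realize_one (hM : InterpretsValuedField O) (v : α → M) :
    (oneTerm : valuedFieldLanguage.Term α).realize v = 1 :=
  hM.one _

theorem realize_valuationLT (hM : InterpretsValuedField O) (s t : valuedFieldLanguage.Term α) (v : α → M) :
    (valuationLT s t).Realize v ↔ O.valuation (s.realize v) < O.valuation (t.realize v) := by
  have hr : ∀ (s : valuedFieldLanguage.Term α) (z : M),
      (s.relabel (Sum.inl : α → α ⊕ Fin 1)).realize (Sum.elim v (Fin.snoc default z)) =
        s.realize v := by
    intro s z
    rw [Term.realize_relabel, Sum.elim_comp_inl]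
  have key : (valuationLT s t).Realize v ↔ ∃ z : M, (O.valuation z < 1 ∧
      s.realize v = t.realize v * z) ∧ t.realize v ≠ 0 := by
    simp only [valuationLT, Formula.Realize, BoundedFormula.realize_ex,
      BoundedFormula.realize_inf, BoundedFormula.realize_not]
    refine exists_congr fun z => and_congr (and_congr ?_ ?_) (not_congr ?_)
    · exact hM.mem _
    · refine Iff.trans (Iff.of_eq rfl : _ ↔ Term.realize _ _ = Term.realize _ _) ?_
      rw [hM.realize_mul, hr, hr]
      rfl
    · refine Iff.trans (Iff.of_eq rfl : _ ↔ Term.realize _ _ = Term.realize _ _) ?_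
      rw [hM.realize_zero, hr]
  rw [key]
  constructor
  · rintro ⟨z, ⟨hz, hst⟩, ht⟩
    rw [hst, map_mul]
    exact mul_lt_of_lt_one_right (zero_lt_iff.2 (O.valuation.ne_zero_iff.2 ht)) hz
  · intro hlt
    have ht : t.realize v ≠ 0 := by
      intro h0
      rw [h0, map_zero] at hlt
      exact not_lt_zero hlt
    refine ⟨s.realize v / t.realize v, ⟨?_, by field_simp⟩, ht⟩
    rwa [map_div₀, div_lt_one₀ (zero_lt_iff.2 (O.valuation.ne_zero_iff.2 ht))]

end InterpretsValuedField

end Interpretation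

/-! ### Back-and-forth: valuation comparisons determine the type. -/

section BackAndForth

open Polynomial

variable {M : Type w} [Field M]

/-- The ring of pairs of values of the integral polynomials at two tuples. -/
def pairRing {α : Type*} (v v' : α → M) : Subring (M × M) :=
  Subring.closure (Set.range fun i => (v i, v' i))

/-- Two tuples have the same quantifier-free type: comparisons between the valuations of integral
polynomials have the same outcome. -/
def SameValues (O : ValuationSubring M) {α : Type*} (v v' : α → M) : Prop :=
  ∀ x ∈ pairRing v v', ∀ y ∈ pairRing v v',
    (O.valuation x.1 < O.valuation y.1 ↔ O.valuation x.2 < O.valuation y.2)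

variable {O : ValuationSubring M} {α β : Type*} {v v' : α → M}

namespace SameValues

theorem comp (h : SameValues O v v') (f : β → α) : SameValues O (v ∘ f) (v' ∘ f) := by
  have hle : pairRing (v ∘ f) (v' ∘ f) ≤ pairRing v v' := by
    refine Subring.closure_mono ?_
    rintro _ ⟨i, rfl⟩
    exact ⟨f i, rfl⟩
  exact fun x hx y hy => h x (hle hx) y (hle hy)

theorem symm (h : SameValues O v v') : SameValues O v' v := by
  have hswap : ∀ x ∈ pairRing v' v, x.swap ∈ pairRing v v' := by
    intro x hx
    have hle : pairRing v' v ≤ (pairRing v v').comap (RingEquiv.prodComm : M × M ≃+* M × M).toRingHom := by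
      refine Subring.closure_le.2 ?_
      rintro _ ⟨i, rfl⟩
      exact Subring.subset_closure ⟨i, rfl⟩
    exact hle hx
  exact fun x hx y hy => (h _ (hswap x hx) _ (hswap y hy)).symm

theorem eq_zero_iff (h : SameValues O v v') {x : M × M} (hx : x ∈ pairRing v v') :
    x.1 = 0 ↔ x.2 = 0 := by
  have := h 0 (zero_mem _) x hx
  simp only [Prod.fst_zero, Prod.snd_zero, map_zero] at this
  rw [zero_lt_iff, zero_lt_iff, Valuation.ne_zero_iff, Valuation.ne_zero_iff] at this
  exact not_iff_not.1 this

/-- A field with two embeddings realising the partial isomorphism between two tuples with the same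
quantifier-free type. -/
theorem exists_field (h : SameValues O v v') : ∃ (F : Type w) (_ : Field F) (j₁ j₂ : F →+* M)
    (c : α → F), O.comap j₁ = O.comap j₂ ∧ (∀ i, j₁ (c i) = v i) ∧ ∀ i, j₂ (c i) = v' i := by
  set A := pairRing v v'
  let p₁ : A →+* M := (RingHom.fst M M).comp A.subtype
  let p₂ : A →+* M := (RingHom.snd M M).comp A.subtype
  -- A polynomial vanishes at one tuple exactly when it vanishes at the other, so the ring of pairs
  -- embeds into `M` by either projection.
  have hp₁ : Function.Injective p₁ := (injective_iff_map_eq_zero p₁).2 fun x hx =>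
    Subtype.ext (Prod.ext hx ((h.eq_zero_iff x.2).1 hx))
  have hp₂ : Function.Injective p₂ := (injective_iff_map_eq_zero p₂).2 fun x hx =>
    Subtype.ext (Prod.ext ((h.eq_zero_iff x.2).2 hx) hx)
  have : IsDomain A := hp₁.isDomain p₁
  refine ⟨FractionRing A, inferInstance, IsFractionRing.lift hp₁, IsFractionRing.lift hp₂,
    fun i => algebraMap A _ ⟨_, Subring.subset_closure ⟨i, rfl⟩⟩, ?_,
    fun i => IsFractionRing.lift_algebraMap hp₁ _, fun i => IsFractionRing.lift_algebraMap hp₂ _⟩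
  ext x
  obtain ⟨a, b, hb, rfl⟩ := IsFractionRing.div_surjective (A := A) x
  have hb0 : b ≠ 0 := nonZeroDivisors.ne_zero hb
  rw [ValuationSubring.mem_comap, ValuationSubring.mem_comap, map_div₀, map_div₀,
    IsFractionRing.lift_algebraMap, IsFractionRing.lift_algebraMap, IsFractionRing.lift_algebraMap,
    IsFractionRing.lift_algebraMap,
    ← O.valuation_le_iff_div_mem ((map_ne_zero_iff p₁ hp₁).2 hb0),
    ← O.valuation_le_iff_div_mem ((map_ne_zero_iff p₂ hp₂).2 hb0), ← not_lt, ← not_lt]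
  exact not_congr (h _ b.2 _ a.2)

end SameValues

variable [valuedFieldLanguage.Structure M]

namespace InterpretsValuedField

theorem realize_pair_mem (hM : InterpretsValuedField O) (v v' : α → M)
    (t : valuedFieldLanguage.Term α) : (t.realize v, t.realize v') ∈ pairRing v v' := by
  induction t with
  | var i => exact Subring.subset_closure ⟨i, rfl⟩
  | func f ts ih =>
    cases f with
    | add =>
      have := add_mem (ih 0) (ih 1)
      convert! this using 1
      exact Prod.ext (hM.add _) (hM.add _)
    | mul =>
      have := mul_mem (ih 0) (ih 1)
      convert! this using 1
      exact Prod.ext (hM.mul _) (hM.mul _)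
    | neg =>
      have := neg_mem (ih 0)
      convert! this using 1
      exact Prod.ext (hM.neg _) (hM.neg _)
    | zero =>
      have := zero_mem (pairRing v v')
      convert! this using 1
      exact Prod.ext (hM.zero _) (hM.zero _)
    | one =>
      have := one_mem (pairRing v v')
      convert! this using 1
      exact Prod.ext (hM.one _) (hM.one _)

theorem exists_term_of_mem_pairRing (hM : InterpretsValuedField O) {v v' : α → M} {x : M × M}
    (hx : x ∈ pairRing v v') :
    ∃ t : valuedFieldLanguage.Term α, t.realize v = x.1 ∧ t.realize v' = x.2 := by
  induction hx using Subring.closure_induction with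
  | mem x hx => obtain ⟨i, rfl⟩ := hx; exact ⟨Term.var i, rfl, rfl⟩
  | zero => exact ⟨zeroTerm, hM.realize_zero _, hM.realize_zero _⟩
  | one => exact ⟨oneTerm, hM.realize_one _, hM.realize_one _⟩
  | add x y _ _ hx hy =>
    obtain ⟨s, hs, hs'⟩ := hx
    obtain ⟨t, ht, ht'⟩ := hy
    exact ⟨addTerm s t, by rw [hM.realize_add, hs, ht]; rfl, by rw [hM.realize_add, hs', ht']; rfl⟩
  | neg x _ hx =>
    obtain ⟨s, hs, hs'⟩ := hx
    exact ⟨negTerm s, by rw [hM.realize_neg, hs]; rfl, by rw [hM.realize_neg, hs']; rfl⟩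
  | mul x y _ _ hx hy =>
    obtain ⟨s, hs, hs'⟩ := hx
    obtain ⟨t, ht, ht'⟩ := hy
    exact ⟨mulTerm s t, by rw [hM.realize_mul, hs, ht]; rfl, by rw [hM.realize_mul, hs', ht']; rfl⟩

theorem exists_term_of_mem_closure (hM : InterpretsValuedField O) {v : α → M} {x : M}
    (hx : x ∈ Subring.closure (Set.range v)) :
    ∃ t : valuedFieldLanguage.Term α, t.realize v = x := by
  induction hx using Subring.closure_induction with
  | mem x hx => obtain ⟨i, rfl⟩ := hx; exact ⟨Term.var i, rfl⟩
  | zero => exact ⟨zeroTerm, hM.realize_zero _⟩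
  | one => exact ⟨oneTerm, hM.realize_one _⟩
  | add x y _ _ hx hy =>
    obtain ⟨s, rfl⟩ := hx
    obtain ⟨t, rfl⟩ := hy
    exact ⟨addTerm s t, hM.realize_add _ _ _⟩
  | neg x _ hx =>
    obtain ⟨s, rfl⟩ := hx
    exact ⟨negTerm s, hM.realize_neg _ _⟩
  | mul x y _ _ hx hy =>
    obtain ⟨s, rfl⟩ := hx
    obtain ⟨t, rfl⟩ := hy
    exact ⟨mulTerm s t, hM.realize_mul _ _ _⟩

/-- A term is a polynomial in its last variable. -/
theorem exists_polynomial_of_term (hM : InterpretsValuedField O) {F : Type*} [Field F] (c : α → F)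
    (t : valuedFieldLanguage.Term (α ⊕ Unit)) :
    ∃ P : F[X], ∀ (j : F →+* M) (b : M),
      t.realize (Sum.elim (fun i => j (c i)) fun _ => b) = (P.map j).eval b := by
  induction t with
  | var i =>
    rcases i with i | i
    · exact ⟨C (c i), fun j b => by simp⟩
    · exact ⟨X, fun j b => by simp⟩
  | func f ts ih =>
    choose P hP using ih
    cases f with
    | add => exact ⟨P 0 + P 1, fun j b => by
        rw [Polynomial.map_add, eval_add, ← hP, ← hP]; exact hM.add _⟩
    | mul => exact ⟨P 0 * P 1, fun j b => by
        rw [Polynomial.map_mul, eval_mul, ← hP, ← hP]; exact hM.mul _⟩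
    | neg => exact ⟨-P 0, fun j b => by
        rw [Polynomial.map_neg, eval_neg, ← hP]; exact hM.neg _⟩
    | zero => exact ⟨0, fun j b => by
        rw [Polynomial.map_zero, eval_zero]; exact hM.zero _⟩
    | one => exact ⟨1, fun j b => by
        rw [Polynomial.map_one, eval_one]; exact hM.one _⟩

variable [IsAlgClosed M]

/-- The extension step of the back-and-forth argument. -/
theorem exists_sameValues_extension (hM : InterpretsValuedField O) (hO : O ≠ ⊤)
    (hsat : IsSaturatedStructure valuedFieldLanguage M ℵ₀) [Finite α] {v v' : α → M}
    (h : SameValues O v v') (b : M) :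
    ∃ b' : M, SameValues O (Sum.elim v fun _ : Unit => b) (Sum.elim v' fun _ => b') := by
  classical
  set w : α ⊕ Unit → M := Sum.elim v fun _ => b with hw
  -- Each `φ st` is a comparison or its negation, whichever holds at `w`; realising all of them
  -- amounts to `SameValues`.
  let φ : valuedFieldLanguage.Term (α ⊕ Unit) × valuedFieldLanguage.Term (α ⊕ Unit) →
      valuedFieldLanguage.Formula (α ⊕ Unit) := fun st =>
    if (valuationLT st.1 st.2).Realize w then valuationLT st.1 st.2 else ∼(valuationLT st.1 st.2)
  have hφ : ∀ st (w' : α ⊕ Unit → M), (φ st).Realize w' ↔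
      ((valuationLT st.1 st.2).Realize w ↔ (valuationLT st.1 st.2).Realize w') := by
    intro st w'
    simp only [φ]
    split_ifs with hst
    · simp [hst]
    · simp [hst, Formula.realize_not]
  obtain ⟨F, _, j₁, j₂, c, hj, hv, hv'⟩ := h.exists_field
  obtain rfl : (fun i => j₁ (c i)) = v := funext hv
  obtain rfl : (fun i => j₂ (c i)) = v' := funext hv'
  choose P hP using hM.exists_polynomial_of_term c
  obtain ⟨b', hb'⟩ := hsat.exists_realize (fun i => j₂ (c i)) (Set.range φ) (by
    intro q hq
    obtain ⟨K, rfl⟩ : ∃ K : Finset (_ × _), K.image φ = q := by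
      rw [← Set.image_univ, Finset.subset_set_image_iff] at hq
      obtain ⟨K, -, hK⟩ := hq
      exact ⟨K, hK⟩
    set S : Finset F[X] := (K.image fun st => P st.1) ∪ (K.image fun st => P st.2)
    -- Zero polynomials are left out of the product, since splitting passes to divisors only of a
    -- nonzero polynomial.
    obtain ⟨i, l₁, l₂, hsp, rfl, rfl, hl⟩ := exists_splitting_extension_comap_eq O j₁ j₂ hj
      (∏ p ∈ S.filter (· ≠ 0), p)
    obtain ⟨b', hb'⟩ := exists_same_polynomial_comparisons hO hl (S.image (Polynomial.map i)) (by
      intro p' hp'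
      obtain ⟨p, hp, rfl⟩ := Finset.mem_image.1 hp'
      by_cases hp0 : p = 0
      · simp [hp0]
      · refine hsp.of_dvd ?_ (Polynomial.map_dvd i
          (Finset.dvd_prod_of_mem _ (Finset.mem_filter.2 ⟨hp, hp0⟩)))
        exact (Polynomial.map_ne_zero_iff i.injective).2
          (Finset.prod_ne_zero_iff.2 fun p hp => (Finset.mem_filter.1 hp).2)) b
    refine ⟨b', fun ψ hψ => ?_⟩
    obtain ⟨st, hst, rfl⟩ := Finset.mem_image.1 hψ
    rw [hφ, hM.realize_valuationLT, hM.realize_valuationLT, hw, hP, hP, hP, hP]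
    simp only [← Polynomial.map_map]
    exact hb' _ (Finset.mem_image_of_mem _ (Finset.mem_union_left _
      (Finset.mem_image_of_mem (fun st => P st.1) hst))) _ (Finset.mem_image_of_mem _
      (Finset.mem_union_right _ (Finset.mem_image_of_mem (fun st => P st.2) hst))))
  refine ⟨b', fun x hx y hy => ?_⟩
  obtain ⟨s, hs, hs'⟩ := hM.exists_term_of_mem_pairRing hx
  obtain ⟨t, ht, ht'⟩ := hM.exists_term_of_mem_pairRing hy
  have := (hφ (s, t) _).1 (hb' _ ⟨(s, t), rfl⟩)
  rw [hM.realize_valuationLT, hM.realize_valuationLT, hs, ht, hs', ht'] at this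
  exact this

/-- Tuples with the same quantifier-free type satisfy the same formulas. -/
theorem realize_boundedFormula_iff (hM : InterpretsValuedField O) (hO : O ≠ ⊤)
    (hsat : IsSaturatedStructure valuedFieldLanguage M ℵ₀) [Finite α] {n : ℕ}
    (φ : valuedFieldLanguage.BoundedFormula α n) {v v' : α → M} {xs xs' : Fin n → M}
    (h : SameValues O (Sum.elim v xs) (Sum.elim v' xs')) : φ.Realize v xs ↔ φ.Realize v' xs' := by
  induction φ with
  | falsum => exact Iff.rfl
  | equal s t =>
    have h1 := h.eq_zero_iff (sub_mem (hM.realize_pair_mem (Sum.elim v xs) (Sum.elim v' xs') s)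
      (hM.realize_pair_mem _ _ t))
    rw [Prod.fst_sub, Prod.snd_sub, sub_eq_zero, sub_eq_zero] at h1
    exact h1
  | rel R ts =>
    cases R
    have h1 := h _ (hM.realize_pair_mem (Sum.elim v xs) (Sum.elim v' xs') (ts 0)) _ (one_mem _)
    rw [Prod.fst_one, Prod.snd_one, map_one] at h1
    exact (hM.mem fun i => (ts i).realize (Sum.elim v xs)).trans
      (h1.trans (hM.mem fun i => (ts i).realize (Sum.elim v' xs')).symm)
  | imp φ ψ ihφ ihψ => exact imp_congr (ihφ h) (ihψ h)
  | @all n φ ih =>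
    have key : ∀ {v v' : α → M} {xs xs' : Fin n → M}, SameValues O (Sum.elim v xs) (Sum.elim v' xs') →
        ∀ b, ∃ b', SameValues O (Sum.elim v (Fin.snoc xs b : Fin (n + 1) → M))
          (Sum.elim v' (Fin.snoc xs' b' : Fin (n + 1) → M)) := by
      intro v v' xs xs' h b
      obtain ⟨b', hb'⟩ := hM.exists_sameValues_extension hO hsat h b
      refine ⟨b', ?_⟩
      let f : α ⊕ Fin (n + 1) → (α ⊕ Fin n) ⊕ Unit :=
        Sum.elim (fun i => Sum.inl (Sum.inl i))
          (Fin.snoc (fun i => Sum.inl (Sum.inr i)) (Sum.inr ()) : Fin (n + 1) → (α ⊕ Fin n) ⊕ Unit)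
      have hf : ∀ (u : α → M) (ys : Fin n → M) (z : M),
          (Sum.elim (Sum.elim u ys) fun _ => z) ∘ f = Sum.elim u (Fin.snoc ys z : Fin (n + 1) → M) := by
        intro u ys z
        funext i
        rcases i with i | i
        · rfl
        · refine Fin.lastCases ?_ (fun i => ?_) i
          · simp [f]
          · simp [f]
      rw [← hf, ← hf]
      exact hb'.comp f
    rw [BoundedFormula.realize_all, BoundedFormula.realize_all]
    constructor
    · intro H b'
      obtain ⟨b, hb⟩ := key h.symm b'
      exact (ih hb.symm).1 (H b)
    · intro H b
      obtain ⟨b', hb'⟩ := key h b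
      exact (ih hb').2 (H b')

theorem realize_formula_iff (hM : InterpretsValuedField O) (hO : O ≠ ⊤)
    (hsat : IsSaturatedStructure valuedFieldLanguage M ℵ₀) [Finite α]
    (φ : valuedFieldLanguage.Formula α) {v v' : α → M} (h : SameValues O v v') :
    φ.Realize v ↔ φ.Realize v' := by
  refine hM.realize_boundedFormula_iff hO hsat φ ?_
  have hf : ∀ u : α → M, u ∘ (Sum.elim id Fin.elim0 : α ⊕ Fin 0 → α) = Sum.elim u default := by
    intro u
    funext i
    rcases i with i | i
    · rfl
    · exact i.elim0
  rw [← hf, ← hf]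
  exact h.comp _

end InterpretsValuedField

end BackAndForth

/-! ### Infinitesimals and transcendental points. -/

section Infinitesimal

open Polynomial

variable {M : Type w} [Field M] {O : ValuationSubring M}

theorem mem_adjoin_int_iff {s : Set M} {x : M} :
    x ∈ Algebra.adjoin ℤ s ↔ x ∈ Subring.closure s := by
  rw [Algebra.adjoin_int, mem_subalgebraOfSubring]

/-- The exchange principle for algebraic dependence. -/
theorem isAlgebraic_adjoin_insert_exchange {a b : M} {C : Set M}
    (h : IsAlgebraic (Algebra.adjoin ℤ (insert b C)) a)
    (ha : ¬ IsAlgebraic (Algebra.adjoin ℤ C) a) :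
    IsAlgebraic (Algebra.adjoin ℤ (insert a C)) b := by
  classical
  set R := Algebra.adjoin ℤ C
  have hins : ∀ x y : M, IsAlgebraic (Algebra.adjoin ℤ (insert x C)) y ↔
      IsAlgebraic (Algebra.adjoin R {x}) y := by
    intro x y
    rw [Set.insert_eq, Set.union_comm, Algebra.adjoin_union_eq_adjoin_adjoin]
    exact Iff.rfl
  have hbot : ∀ x : M, AlgebraicIndepOn R id {x} ↔ Transcendental R x := fun x =>
    algebraicIndependent_unique_type_iff
  rw [hins] at h ⊢
  by_contra hb
  have hab : a ≠ b := by
    rintro rfl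
    exact hb h
  -- If `b` were transcendental over `a`, the pair would be algebraically independent, a condition
  -- that ignores the order of its members.
  have h1 : AlgebraicIndepOn R id (insert b {a}) :=
    ((hbot a).2 ha).insert (by rwa [Set.image_id])
  rw [Set.pair_comm, AlgebraicIndepOn.insert_iff (by simpa using hab), Set.image_id] at h1
  exact h1.2 h

/-- `e` is smaller than all quotients of nonzero elements of `R`. -/
def IsInfinitesimalOver (O : ValuationSubring M) (R : Subring M) (e : M) : Prop :=
  ∀ s ∈ R, ∀ t ∈ R, s ≠ 0 → O.valuation (e * t) < O.valuation s

theorem IsInfinitesimalOver.valuation_lt_one {R : Subring M} {e : M}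
    (he : IsInfinitesimalOver O R e) : O.valuation e < 1 := by
  simpa using he 1 (one_mem R) 1 (one_mem R) one_ne_zero

theorem IsInfinitesimalOver.mono {R S : Subring M} (hRS : R ≤ S) {e : M}
    (he : IsInfinitesimalOver O S e) : IsInfinitesimalOver O R e :=
  fun s hs t ht => he s (hRS hs) t (hRS ht)

theorem IsInfinitesimalOver.of_valuation_le {R : Subring M} {e e' : M}
    (he : IsInfinitesimalOver O R e) (hle : O.valuation e' ≤ O.valuation e) :
    IsInfinitesimalOver O R e' := by
  intro s hs t ht hs0
  refine lt_of_le_of_lt ?_ (he s hs t ht hs0)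
  rw [map_mul, map_mul]
  exact mul_le_mul_left hle _

/-- The constant term dominates at an infinitesimal point. -/
theorem IsInfinitesimalOver.valuation_eval {R : Subring M} {e : M}
    (he : IsInfinitesimalOver O R e) {q : M[X]} (hq : ∀ k, q.coeff k ∈ R) (hq0 : q.coeff 0 ≠ 0) :
    O.valuation (q.eval e) = O.valuation (q.coeff 0) := by
  rw [eval_eq_sum_range, Finset.sum_range_succ', pow_zero, mul_one]
  refine O.valuation.map_add_eq_of_lt_right (O.valuation.map_sum_lt ?_ fun k _ => ?_)
  · exact O.valuation.ne_zero_iff.2 hq0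
  · have h1 := he _ (hq 0) _ (hq (k + 1)) hq0
    rw [pow_succ, ← mul_assoc, mul_right_comm, mul_comm (q.coeff _), map_mul, map_pow]
    exact (mul_le_of_le_one_right' (pow_le_one' he.valuation_lt_one.le k)).trans_lt h1

/-- Once the powers of the variable are split off, the remaining factor has a nonzero constant term,
which dominates. -/
theorem IsInfinitesimalOver.eval_ne_zero {R : Subring M} {e : M}
    (he : IsInfinitesimalOver O R e) (he0 : e ≠ 0) {q : M[X]} (hq : ∀ k, q.coeff k ∈ R)
    (hq0 : q ≠ 0) : q.eval e ≠ 0 := by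
  obtain ⟨p, hp, hp0⟩ := exists_eq_pow_rootMultiplicity_mul_and_not_dvd q hq0 0
  rw [C_0, sub_zero] at hp hp0
  set n := q.rootMultiplicity 0
  rw [X_dvd_iff] at hp0
  have hpR : ∀ k, p.coeff k ∈ R := fun k => by
    have := hq (k + n)
    rwa [hp, coeff_X_pow_mul] at this
  rw [hp, eval_mul, eval_pow, eval_X]
  refine mul_ne_zero (pow_ne_zero _ he0) fun h0 => ?_
  have := he.valuation_eval hpR hp0
  rw [h0, map_zero] at this
  exact hp0 ((map_eq_zero O.valuation).1 this.symm)

theorem IsInfinitesimalOver.transcendental {A : Set M} {e : M}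
    (he : IsInfinitesimalOver O (Subring.closure A) e) (he0 : e ≠ 0) :
    Transcendental (Algebra.adjoin ℤ A) e := by
  rintro ⟨P, hP, hPe⟩
  refine he.eval_ne_zero he0 (q := P.map (algebraMap _ M)) (fun k => ?_) ?_ ?_
  · rw [coeff_map]
    exact mem_adjoin_int_iff.1 (P.coeff k).2
  · exact (Polynomial.map_ne_zero_iff Subtype.val_injective).2 hP
  · rw [eval_map_algebraMap, hPe]

/-- This is the finite satisfiability behind `exists_infinitesimal`: `e` is shrunk for each new
constraint, which preserves the earlier ones. -/
theorem exists_valuation_mul_lt (hO : O ≠ ⊤) (K : Finset (M × M)) (hK : ∀ p ∈ K, p.1 ≠ 0) :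
    ∃ e : M, e ≠ 0 ∧ ∀ p ∈ K, O.valuation (e * p.2) < O.valuation p.1 := by
  classical
  have hpos : ∀ {x : M}, x ≠ 0 → 0 < O.valuation x :=
    fun hx => zero_lt_iff.2 (O.valuation.ne_zero_iff.2 hx)
  obtain ⟨π, hπ0, hπ⟩ := ValuationSubring.exists_pos_valuation_lt_one hO
  induction K using Finset.induction_on with
  | empty => exact ⟨1, one_ne_zero, by simp⟩
  | insert p K _ ih =>
    obtain ⟨e, he0, he⟩ := ih fun q hq => hK q (Finset.mem_insert_of_mem hq)
    have hp0 := hK p (Finset.mem_insert_self _ _)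
    by_cases hp : O.valuation (e * p.2) < O.valuation p.1
    · refine ⟨e, he0, fun q hq => ?_⟩
      rcases Finset.mem_insert.1 hq with rfl | hq
      · exact hp
      · exact he q hq
    · have hp2 : p.2 ≠ 0 := by
        intro h0
        rw [h0, mul_zero, map_zero] at hp
        exact hp (hpos hp0)
      refine ⟨p.1 / p.2 * π, mul_ne_zero (div_ne_zero hp0 hp2) hπ0, fun q hq => ?_⟩
      have hlt : O.valuation (p.1 * π) < O.valuation p.1 := by
        rw [map_mul]
        exact mul_lt_of_lt_one_right (hpos hp0) hπ
      rcases Finset.mem_insert.1 hq with rfl | hq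
      · rwa [show q.1 / q.2 * π * q.2 = q.1 * π by field_simp]
      · refine lt_of_le_of_lt ?_ (he q hq)
        rw [map_mul, map_mul _ e]
        refine mul_le_mul_left ?_ _
        rw [show p.1 / p.2 * π = p.1 * π / p.2 by ring, map_div₀,
          div_le_iff₀ (hpos hp2), ← map_mul]
        exact hlt.le.trans (not_lt.1 hp)

theorem infinite_closedBall (hO : O ≠ ⊤) (b : M) {e : M} (he : e ≠ 0) :
    {c : M | O.valuation (c - b) ≤ O.valuation e}.Infinite := by
  obtain ⟨π, hπ0, hπ⟩ := ValuationSubring.exists_pos_valuation_lt_one hO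
  refine Set.infinite_of_injective_forall_mem (f := fun k : ℕ => b + e * π ^ k) ?_ fun k => ?_
  · intro k l hkl
    have h1 : π ^ k = π ^ l := mul_left_cancel₀ he (add_left_cancel hkl)
    have h2 : O.valuation π ^ k = O.valuation π ^ l := by rw [← map_pow, h1, map_pow]
    exact (pow_right_strictAnti₀ (zero_lt_iff.2 (O.valuation.ne_zero_iff.2 hπ0)) hπ).injective h2
  · rw [Set.mem_ofPred_eq, add_sub_cancel_left, map_mul, map_pow]
    exact mul_le_of_le_one_right' (pow_le_one' hπ.le k)

/-- A point that is transcendental over a tuple may be moved by an infinitesimal. -/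
theorem sameValues_add_infinitesimal {α : Type*} {v : α → M} {b : M}
    (hb : Transcendental (Algebra.adjoin ℤ (Set.range v)) b) {e : M}
    (he : IsInfinitesimalOver O (Subring.closure (insert b (Set.range v))) e) :
    SameValues O (Sum.elim v fun _ : Unit => b) (Sum.elim v fun _ => b + e) := by
  set R := Algebra.adjoin ℤ (Set.range v)
  set S := Subring.closure (insert b (Set.range v))
  have hRS : ∀ r : R, (r : M) ∈ S := fun r =>
    Subring.closure_mono (Set.subset_insert _ _) (mem_adjoin_int_iff.1 r.2)
  have hbS : b ∈ S := Subring.subset_closure (Set.mem_insert _ _)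
  have hP : ∀ x ∈ pairRing (Sum.elim v fun _ : Unit => b) (Sum.elim v fun _ => b + e),
      ∃ P : R[X], x = (aeval b P, aeval (b + e) P) := by
    intro x hx
    induction hx using Subring.closure_induction with
    | mem x hx =>
      obtain ⟨i | i, rfl⟩ := hx
      · exact ⟨C ⟨v i, Algebra.subset_adjoin ⟨i, rfl⟩⟩, by simp [aeval_C]⟩
      · exact ⟨X, by simp⟩
    | zero => exact ⟨0, by rw [map_zero, map_zero]; rfl⟩
    | one => exact ⟨1, by rw [map_one, map_one]; rfl⟩
    | add x y _ _ hx hy =>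
      obtain ⟨P, rfl⟩ := hx
      obtain ⟨Q, rfl⟩ := hy
      exact ⟨P + Q, by simp⟩
    | neg x _ hx =>
      obtain ⟨P, rfl⟩ := hx
      exact ⟨-P, by simp⟩
    | mul x y _ _ hx hy =>
      obtain ⟨P, rfl⟩ := hx
      obtain ⟨Q, rfl⟩ := hy
      exact ⟨P * Q, by simp⟩
  have hval : ∀ x ∈ pairRing (Sum.elim v fun _ : Unit => b) (Sum.elim v fun _ => b + e),
      O.valuation x.1 = O.valuation x.2 := by
    intro x hx
    obtain ⟨P, rfl⟩ := hP x hx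
    by_cases hP0 : P = 0
    · simp [hP0]
    have hPb : aeval b P ≠ 0 := fun h0 => hb ⟨P, hP0, h0⟩
    set p := P.map (algebraMap R M)
    -- In the Taylor expansion at `b` the constant term is nonzero by transcendence, so it dominates
    -- at `e`; all coefficients lie in `S`.
    have h1 : (taylor b p).coeff 0 = aeval b P := by
      rw [taylor_coeff_zero, eval_map_algebraMap]
    have h2 : (taylor b p).eval e = aeval (b + e) P := by
      rw [taylor_eval, eval_map_algebraMap, add_comm]
    have h3 := he.valuation_eval (q := taylor b p) (fun k => ?_) (h1 ▸ hPb)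
    · rw [h1, h2] at h3
      exact h3.symm
    · rw [taylor_coeff, eval_eq_sum_range]
      refine sum_mem fun i _ => mul_mem ?_ (pow_mem hbS i)
      rw [hasseDeriv_coeff, coeff_map]
      exact mul_mem (natCast_mem _ _) (hRS _)
  intro x hx y hy
  rw [hval x hx, hval y hy]

end Infinitesimal

/-! ### Balls in definable sets; model-theoretic algebraic closure. -/

section AlgebraicClosure

open Polynomial

variable {M : Type w} [Field M] {O : ValuationSubring M} [valuedFieldLanguage.Structure M]
  {α : Type*}

namespace InterpretsValuedField

theorem exists_term_of_polynomial (hM : InterpretsValuedField O) {v : α → M}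
    (P : (Algebra.adjoin ℤ (Set.range v))[X]) :
    ∃ t : valuedFieldLanguage.Term (α ⊕ Unit), ∀ c : M,
      t.realize (Sum.elim v fun _ => c) = aeval c P := by
  induction P using Polynomial.induction_on with
  | C a =>
    obtain ⟨t, ht⟩ := hM.exists_term_of_mem_closure (mem_adjoin_int_iff.1 a.2)
    exact ⟨t.relabel Sum.inl, fun c => by
      rw [Term.realize_relabel, Sum.elim_comp_inl, ht, aeval_C]; rfl⟩
  | add P Q hP hQ =>
    obtain ⟨s, hs⟩ := hP
    obtain ⟨t, ht⟩ := hQ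
    exact ⟨addTerm s t, fun c => by rw [hM.realize_add, hs, ht, map_add]⟩
  | monomial n a hP =>
    obtain ⟨t, ht⟩ := hP
    refine ⟨mulTerm t (Term.var (Sum.inr ())), fun c => ?_⟩
    rw [hM.realize_mul, ht, pow_succ, ← mul_assoc, map_mul _ _ X, aeval_X]
    rfl

theorem exists_infinitesimal (hM : InterpretsValuedField O) (hO : O ≠ ⊤)
    (hsat : IsSaturatedStructure valuedFieldLanguage M ℵ₀) {A : Set M} (hA : A.Finite) :
    ∃ e : M, e ≠ 0 ∧ IsInfinitesimalOver O (Subring.closure A) e := by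
  classical
  have := hA.to_subtype
  set v : A → M := Subtype.val
  let y : valuedFieldLanguage.Term (A ⊕ Unit) := Term.var (Sum.inr ())
  let φ : valuedFieldLanguage.Term A × valuedFieldLanguage.Term A →
      valuedFieldLanguage.Formula (A ⊕ Unit) := fun p =>
    valuationLT (mulTerm y (p.2.relabel Sum.inl)) (p.1.relabel Sum.inl)
  have hφ : ∀ p e, (φ p).Realize (Sum.elim v fun _ => e) ↔
      O.valuation (e * p.2.realize v) < O.valuation (p.1.realize v) := by
    intro p e
    simp only [φ]
    rw [hM.realize_valuationLT, hM.realize_mul, Term.realize_relabel, Term.realize_relabel,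
      Sum.elim_comp_inl]
    rfl
  have h0 : ∀ e, (valuationLT zeroTerm y).Realize (Sum.elim v fun _ => e) ↔ e ≠ 0 := by
    intro e
    rw [hM.realize_valuationLT, hM.realize_zero, map_zero, zero_lt_iff, Valuation.ne_zero_iff]
    rfl
  obtain ⟨e, he⟩ := hsat.exists_realize v
    (insert (valuationLT zeroTerm y) (φ '' {p | p.1.realize v ≠ 0})) (by
    intro q hq
    obtain ⟨K, hK, hKq⟩ := Finset.subset_set_image_iff.1
      (show ((q.erase (valuationLT zeroTerm y) : Finset _) : Set _) ⊆ φ '' {p | p.1.realize v ≠ 0} from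
        fun ψ hψ => (hq (Finset.mem_of_mem_erase hψ)).resolve_left (Finset.ne_of_mem_erase hψ))
    obtain ⟨e, he0, he⟩ := exists_valuation_mul_lt hO
      (K.image fun p => (p.1.realize v, p.2.realize v)) (by
        intro p hp
        obtain ⟨p, hp', rfl⟩ := Finset.mem_image.1 hp
        exact hK hp')
    refine ⟨e, fun ψ hψ => ?_⟩
    by_cases hψ0 : ψ = valuationLT zeroTerm y
    · rw [hψ0, h0]; exact he0
    · have := Finset.mem_erase.2 ⟨hψ0, hψ⟩
      rw [← hKq] at this
      obtain ⟨p, hp, rfl⟩ := Finset.mem_image.1 this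
      rw [hφ]
      exact he _ (Finset.mem_image_of_mem _ hp))
  refine ⟨e, (h0 e).1 (he _ (Set.mem_insert _ _)), fun s hs t ht hs0 => ?_⟩
  rw [← Subtype.range_coe (s := A)] at hs ht
  obtain ⟨s, rfl⟩ := hM.exists_term_of_mem_closure hs
  obtain ⟨t, rfl⟩ := hM.exists_term_of_mem_closure ht
  exact (hφ (s, t) e).1 (he _ (Set.mem_insert_of_mem _ ⟨(s, t), hs0, rfl⟩))

variable [IsAlgClosed M]

/-- A definable set contains a ball around each of its points that is transcendental over the
parameters. -/
theorem exists_ball_subset_of_transcendental (hM : InterpretsValuedField O) (hO : O ≠ ⊤)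
    (hsat : IsSaturatedStructure valuedFieldLanguage M ℵ₀) [Finite α] {v : α → M}
    (φ : valuedFieldLanguage.Formula (α ⊕ Unit)) {b : M}
    (hb : Transcendental (Algebra.adjoin ℤ (Set.range v)) b)
    (hφ : φ.Realize (Sum.elim v fun _ => b)) :
    ∃ e : M, e ≠ 0 ∧ ∀ c, O.valuation (c - b) ≤ O.valuation e →
      φ.Realize (Sum.elim v fun _ => c) := by
  obtain ⟨e, he0, he⟩ := hM.exists_infinitesimal hO hsat ((Set.finite_range v).insert b)
  refine ⟨e, he0, fun c hc => ?_⟩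
  have := sameValues_add_infinitesimal hb (he.of_valuation_le hc)
  rw [add_sub_cancel] at this
  exact (hM.realize_formula_iff hO hsat φ this).1 hφ

/-- An infinite set is not covered by finitely many finite zero sets of terms, so by saturation it
has a point transcendental over the parameters, around which it contains a ball. -/
theorem exists_ball_subset_of_infinite (hM : InterpretsValuedField O) (hO : O ≠ ⊤)
    (hsat : IsSaturatedStructure valuedFieldLanguage M ℵ₀) [Finite α] {v : α → M}
    (φ : valuedFieldLanguage.Formula (α ⊕ Unit))
    (hφ : {c : M | φ.Realize (Sum.elim v fun _ => c)}.Infinite) :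
    ∃ b e : M, e ≠ 0 ∧ ∀ c, O.valuation (c - b) ≤ O.valuation e →
      φ.Realize (Sum.elim v fun _ => c) := by
  classical
  let ψ : valuedFieldLanguage.Term (α ⊕ Unit) → valuedFieldLanguage.Formula (α ⊕ Unit) :=
    fun t => ∼(t.equal zeroTerm)
  have hψ : ∀ t c, (ψ t).Realize (Sum.elim v fun _ => c) ↔
      t.realize (Sum.elim v fun _ => c) ≠ 0 := by
    intro t c
    simp only [ψ]
    rw [Formula.realize_not, Formula.realize_equal, hM.realize_zero]
  obtain ⟨b, hb⟩ := hsat.exists_realize v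
    (insert φ (ψ '' {t | {c : M | t.realize (Sum.elim v fun _ => c) = 0}.Finite})) (by
    intro q hq
    obtain ⟨K, hK, hKq⟩ := Finset.subset_set_image_iff.1
      (show ((q.erase φ : Finset _) : Set _) ⊆
          ψ '' {t | {c : M | t.realize (Sum.elim v fun _ => c) = 0}.Finite} from
        fun χ hχ => (hq (Finset.mem_of_mem_erase hχ)).resolve_left (Finset.ne_of_mem_erase hχ))
    have hfin : (⋃ t ∈ K, {c : M | t.realize (Sum.elim v fun _ => c) = 0}).Finite :=
      K.finite_toSet.biUnion fun t ht => hK ht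
    obtain ⟨b, hb, hbK⟩ := hφ.exists_notMem_finite hfin
    refine ⟨b, fun χ hχ => ?_⟩
    by_cases hχ0 : χ = φ
    · rw [hχ0]; exact hb
    · have := Finset.mem_erase.2 ⟨hχ0, hχ⟩
      rw [← hKq] at this
      obtain ⟨t, ht, rfl⟩ := Finset.mem_image.1 this
      rw [hψ]
      exact fun h0 => hbK (Set.mem_biUnion ht h0))
  have htr : Transcendental (Algebra.adjoin ℤ (Set.range v)) b := by
    rintro ⟨P, hP0, hPb⟩
    obtain ⟨t, ht⟩ := hM.exists_term_of_polynomial P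
    refine (hψ t b).1 (hb _ (Set.mem_insert_of_mem _ ⟨t, ?_, rfl⟩)) (by rw [ht, hPb])
    refine ((P.map (algebraMap _ M)).roots.toFinset.finite_toSet).subset fun c hc => ?_
    rw [Set.mem_ofPred_eq, ht] at hc
    rw [Finset.mem_coe, Multiset.mem_toFinset, mem_roots
      ((Polynomial.map_ne_zero_iff Subtype.val_injective).2 hP0), IsRoot, eval_map_algebraMap]
    exact hc
  obtain ⟨e, he⟩ := hM.exists_ball_subset_of_transcendental hO hsat φ htr
    (hb φ (Set.mem_insert _ _))
  exact ⟨b, e, he⟩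

/-- The model-theoretic algebraic closure is the field-theoretic one. -/
theorem mem_modelAcl_iff (hM : InterpretsValuedField O) (hO : O ≠ ⊤)
    (hsat : IsSaturatedStructure valuedFieldLanguage M ℵ₀) {A : Set M} {b : M} :
    b ∈ modelAcl valuedFieldLanguage A ↔ IsAlgebraic (Algebra.adjoin ℤ A) b := by
  constructor
  · classical
    rintro ⟨s, hs, hfin, hb⟩
    by_contra htr
    -- Saturation is available over finite parameter sets only.
    obtain ⟨A₀, hA₀, hs₀⟩ := Set.definable_iff_finitely_definable.1 hs
    obtain ⟨φ, hφ⟩ := Set.definable_iff_exists_formula_sum.1 hs₀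
    have hφ' : ∀ c, c ∈ s ↔ (φ.relabel (Sum.map id fun _ => ())).Realize
        (Sum.elim (fun a : (A₀ : Set M) => (a : M)) fun _ : Unit => c) := by
      intro c
      have := Set.ext_iff.1 hφ fun _ => c
      rw [Formula.realize_relabel, Sum.elim_comp_map]
      exact this
    have htr₀ : Transcendental
        (Algebra.adjoin ℤ (Set.range fun a : (A₀ : Set M) => (a : M))) b := by
      rw [Subtype.range_coe]
      intro halg
      refine htr (IsAlgebraic.adjoin_of_forall_isAlgebraic (fun x hx => ?_) halg)
      exact absurd (hA₀ hx.1) hx.2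
    obtain ⟨e, he0, he⟩ := hM.exists_ball_subset_of_transcendental hO hsat _ htr₀ ((hφ' b).1 hb)
    exact infinite_closedBall hO b he0 (hfin.subset fun c hc => (hφ' c).2 (he c hc))
  · classical
    rintro ⟨P, hP0, hPb⟩
    refine ⟨{c | aeval c P = 0}, ?_, ?_, hPb⟩
    · rw [Set.Definable₁, Set.definable_iff_exists_formula_sum]
      obtain ⟨Q, hQ⟩ : ∃ Q : (Algebra.adjoin ℤ (Set.range (Subtype.val : A → M)))[X],
          ∀ c : M, aeval c Q = aeval c P := by
        rw [Subtype.range_coe]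
        exact ⟨P, fun _ => rfl⟩
      obtain ⟨t, ht⟩ := hM.exists_term_of_polynomial Q
      refine ⟨(t.relabel (Sum.map id fun _ => 0)).equal zeroTerm, ?_⟩
      ext x
      rw [Set.mem_ofPred_eq, Set.mem_ofPred_eq, Set.mem_ofPred_eq, Formula.realize_equal, hM.realize_zero, Term.realize_relabel,
        Sum.elim_comp_map, ← hQ, ← ht]
      rfl
    · refine ((P.map (algebraMap _ M)).roots.toFinset.finite_toSet).subset fun c hc => ?_
      rw [Finset.mem_coe, Multiset.mem_toFinset, mem_roots
        ((Polynomial.map_ne_zero_iff Subtype.val_injective).2 hP0), IsRoot, eval_map_algebraMap]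
      exact hc

end InterpretsValuedField

end AlgebraicClosure

/-! ### Uniform finiteness and geometricity. -/

section UniformFiniteness

/-- Saturation over finite sets, for decreasing sequences of conditions on a finite tuple. -/
theorem IsSaturatedStructure.exists_realize_tuple {L : FirstOrder.Language.{u, v}} {M : Type w}
    [L.Structure M] (hM : IsSaturatedStructure L M ℵ₀) {n : ℕ} {α : Type} [Finite α] (a : α → M)
    (φ : ℕ → L.Formula (α ⊕ Fin n))
    (hanti : ∀ k l, k ≤ l → ∀ x, (φ l).Realize (Sum.elim a x) → (φ k).Realize (Sum.elim a x))
    (hne : ∀ k, ∃ x, (φ k).Realize (Sum.elim a x)) :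
    ∃ x, ∀ k, (φ k).Realize (Sum.elim a x) := by
  classical
  induction n generalizing α with
  | zero =>
    refine ⟨Fin.elim0, fun k => ?_⟩
    obtain ⟨x, hx⟩ := hne k
    rwa [Subsingleton.elim Fin.elim0 x]
  | succ n ih =>
    let r : α ⊕ Fin (n + 1) → (α ⊕ Unit) ⊕ Fin n :=
      Sum.elim (fun i => Sum.inl (Sum.inl i)) (Fin.cons (Sum.inl (Sum.inr ())) Sum.inr)
    have hr : ∀ (y : M) (x : Fin n → M),
        Sum.elim (Sum.elim a fun _ => y) x ∘ r = Sum.elim a (Fin.cons y x : Fin (n + 1) → M) := by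
      intro y x
      funext i
      rcases i with i | i
      · rfl
      · refine Fin.cases rfl (fun i => ?_) i
        simp [r]
    have hψ : ∀ k y x, ((φ k).relabel r).Realize (Sum.elim (Sum.elim a fun _ => y) x) ↔
        (φ k).Realize (Sum.elim a (Fin.cons y x : Fin (n + 1) → M)) := fun k y x => by
      rw [Formula.realize_relabel, hr]
    obtain ⟨y, hy⟩ := hM.exists_realize a (Set.range fun k => ((φ k).relabel r).iExs (Fin n)) (by
      intro q hq
      rw [← Set.image_univ, Finset.subset_set_image_iff] at hq
      obtain ⟨K, -, rfl⟩ := hq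
      obtain ⟨x, hx⟩ := hne (K.sup id)
      refine ⟨x 0, fun ψ hψ' => ?_⟩
      obtain ⟨k, hk, rfl⟩ := Finset.mem_image.1 hψ'
      rw [Formula.realize_iExs]
      refine ⟨Fin.tail x, (hψ _ _ _).2 ?_⟩
      rw [Fin.cons_self_tail]
      exact hanti k _ (Finset.le_sup (f := id) hk) x hx)
    obtain ⟨x, hx⟩ := ih (Sum.elim a fun _ => y) (fun k => (φ k).relabel r)
      (fun k l hkl x hx => (hψ _ _ _).2 (hanti k l hkl _ ((hψ _ _ _).1 hx)))
      (fun k => Formula.realize_iExs.1 (hy _ ⟨k, rfl⟩))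
    exact ⟨Fin.cons y x, fun k => (hψ _ _ _).1 (hx k)⟩

/-- The formula saying that `ψ(x, ·)` has at least `k` solutions. -/
noncomputable def atLeastSolutions {L : FirstOrder.Language.{u, v}} {α : Type*}
    (ψ : L.Formula (α ⊕ Unit)) (k : ℕ) : L.Formula α :=
  Formula.iExs (Fin k) (
    Formula.iInf (fun i : Fin k => ψ.relabel (Sum.map id fun _ => i)) ⊓
    Formula.iInf (fun p : {p : Fin k × Fin k // p.1 ≠ p.2} =>
      ∼((Term.var (Sum.inr p.1.1) : L.Term (α ⊕ Fin k)).equal (Term.var (Sum.inr p.1.2)))))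

theorem realize_atLeastSolutions {L : FirstOrder.Language.{u, v}} {M : Type w} [L.Structure M]
    {α : Type*} (ψ : L.Formula (α ⊕ Unit)) (k : ℕ) (a : α → M) :
    (atLeastSolutions ψ k).Realize a ↔ ∃ x : Fin k → M, Function.Injective x ∧
      ∀ i, ψ.Realize (Sum.elim a fun _ => x i) := by
  rw [atLeastSolutions, Formula.realize_iExs]
  refine exists_congr fun x => ?_
  rw [Formula.realize_inf, Formula.realize_iInf, Formula.realize_iInf, and_comm]
  refine and_congr ⟨fun h i j hij => ?_, fun h p => ?_⟩ (forall_congr' fun i => ?_)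
  · by_contra hne
    have := h ⟨(i, j), hne⟩
    rw [Formula.realize_not, Formula.realize_equal] at this
    exact this hij
  · rw [Formula.realize_not, Formula.realize_equal]
    exact fun he => p.2 (h he)
  · rw [Formula.realize_relabel, Sum.elim_comp_map]
    exact Iff.rfl

variable {M : Type w} [Field M] {O : ValuationSubring M} [valuedFieldLanguage.Structure M]

/-- The formula saying that `ψ(x, ·)` contains no ball. -/
noncomputable def containsNoBall {α : Type*} (ψ : valuedFieldLanguage.Formula (α ⊕ Unit)) :
    valuedFieldLanguage.Formula α :=
  Formula.iAlls (Fin 2) (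
    ((Term.var (Sum.inr 1) : valuedFieldLanguage.Term (α ⊕ Fin 2)).equal zeroTerm) ⊔
    Formula.iExs Unit (
      (∼(valuationLT (Term.var (Sum.inl (Sum.inr 1)))
        (addTerm (Term.var (Sum.inr ())) (negTerm (Term.var (Sum.inl (Sum.inr 0)))))) :
        valuedFieldLanguage.Formula ((α ⊕ Fin 2) ⊕ Unit)) ⊓
      ∼(ψ.relabel (Sum.map Sum.inl id))))

theorem InterpretsValuedField.realize_containsNoBall (hM : InterpretsValuedField O) {α : Type*}
    (ψ : valuedFieldLanguage.Formula (α ⊕ Unit)) (a : α → M) :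
    (containsNoBall ψ).Realize a ↔ ∀ b e : M, e ≠ 0 →
      ∃ c, O.valuation (c - b) ≤ O.valuation e ∧ ¬ ψ.Realize (Sum.elim a fun _ => c) := by
  have key : ∀ x : Fin 2 → M, x 1 = 0 ∨ (∃ c : Unit → M, O.valuation (c () - x 0) ≤
      O.valuation (x 1) ∧ ¬ ψ.Realize (Sum.elim a c)) ↔ (x 1 ≠ 0 →
      ∃ c, O.valuation (c - x 0) ≤ O.valuation (x 1) ∧ ¬ ψ.Realize (Sum.elim a fun _ => c)) := by
    intro x
    rw [or_iff_not_imp_left]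
    exact imp_congr Iff.rfl ⟨fun ⟨c, hc⟩ => ⟨c (), hc⟩, fun ⟨c, hc⟩ => ⟨fun _ => c, hc⟩⟩
  have h1 : (containsNoBall ψ).Realize a ↔ ∀ x : Fin 2 → M, x 1 = 0 ∨ (∃ c : Unit → M,
      O.valuation (c () - x 0) ≤ O.valuation (x 1) ∧ ¬ ψ.Realize (Sum.elim a c)) := by
    rw [containsNoBall, Formula.realize_iAlls]
    refine forall_congr' fun x => ?_
    rw [Formula.realize_sup, Formula.realize_equal, hM.realize_zero, Formula.realize_iExs]
    refine or_congr Iff.rfl (exists_congr fun c => ?_)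
    rw [Formula.realize_inf, Formula.realize_not, Formula.realize_not, hM.realize_valuationLT,
      hM.realize_add, hM.realize_neg, not_lt, ← sub_eq_add_neg, Formula.realize_relabel,
      Sum.elim_comp_map, Sum.elim_comp_inl]
    exact Iff.rfl
  rw [h1]
  refine (forall_congr' key).trans ⟨fun h b e he => ?_, fun h x => h (x 0) (x 1)⟩
  exact h ![b, e] he

variable [IsAlgClosed M]

/-- Exchange is inherited from field-theoretic algebraicity. For uniform finiteness, a finite set
contains no ball; without a bound, saturation would produce a parameter tuple whose set has at least
`k` elements for every `k` and still contains no ball. -/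
theorem InterpretsValuedField.isGeometricStructure (hM : InterpretsValuedField O) (hO : O ≠ ⊤)
    (hsat : IsSaturatedStructure valuedFieldLanguage M ℵ₀) :
    IsGeometricStructure valuedFieldLanguage M where
  exchange a b C h ha := by
    rw [hM.mem_modelAcl_iff hO hsat] at *
    exact isAlgebraic_adjoin_insert_exchange h ha
  uniform_finiteness n ψ := by
    classical
    by_contra! hcon
    let φ : ℕ → valuedFieldLanguage.Formula (Empty ⊕ Fin n) := fun k =>
      (containsNoBall ψ ⊓ atLeastSolutions ψ k).relabel Sum.inr
    have hφ : ∀ k (x : Fin n → M), (φ k).Realize (Sum.elim Empty.elim x) ↔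
        (containsNoBall ψ).Realize x ∧ (atLeastSolutions ψ k).Realize x := by
      intro k x
      simp only [φ]
      rw [Formula.realize_relabel, Sum.elim_comp_inr, Formula.realize_inf]
    obtain ⟨a, ha⟩ := hsat.exists_realize_tuple Empty.elim φ
      (fun k l hkl x hx => by
        rw [hφ, realize_atLeastSolutions] at hx ⊢
        obtain ⟨hx1, y, hy, hyψ⟩ := hx
        exact ⟨hx1, y ∘ Fin.castLE hkl, hy.comp (Fin.castLE_injective hkl), fun i => hyψ _⟩)
      (fun k => by
        obtain ⟨a, hfin, hcard⟩ := hcon k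
        refine ⟨a, (hφ k a).2 ⟨(hM.realize_containsNoBall ψ a).2 fun b e he => ?_,
          (realize_atLeastSolutions ψ k a).2 ?_⟩⟩
        · by_contra! hball
          exact infinite_closedBall hO b he (hfin.subset fun c hc => hball c hc)
        · have := hfin.fintype
          obtain ⟨f⟩ := Function.Embedding.nonempty_of_card_le (α := Fin k)
            (β := {b : M | ψ.Realize (Sum.elim a fun _ => b)}) (by
              rw [Fintype.card_fin, ← Nat.card_eq_fintype_card]
              exact (hcard hfin).le)
          exact ⟨fun i => f i, Subtype.val_injective.comp f.injective, fun i => (f i).2⟩)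
    have hinf : {c : M | ψ.Realize (Sum.elim a fun _ => c)}.Infinite := by
      intro hfin
      obtain ⟨x, hx, hxψ⟩ := (realize_atLeastSolutions ψ _ a).1 ((hφ
        ({c : M | ψ.Realize (Sum.elim a fun _ => c)}.ncard + 1) a).1 (ha _)).2
      have h1 : (Set.range x).ncard ≤ {c : M | ψ.Realize (Sum.elim a fun _ => c)}.ncard :=
        Set.ncard_le_ncard (by rintro _ ⟨i, rfl⟩; exact hxψ i) hfin
      rw [← Set.image_univ, Set.ncard_image_of_injective _ hx, Set.ncard_univ, Nat.card_fin] at h1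
      omega
    obtain ⟨b, e, he, hball⟩ := hM.exists_ball_subset_of_infinite hO hsat ψ hinf
    obtain ⟨c, hc, hcψ⟩ := (hM.realize_containsNoBall ψ a).1 ((hφ 0 a).1 (ha 0)).1 b e he
    exact hcψ (hball c hc)

end UniformFiniteness

/-! ### What curves, cylinders and quantifier-free formulas can separate. -/

section Curves

variable {L : FirstOrder.Language.{0, 0}} {M : Type w} [L.Structure M]

theorem aclDim_le_one_of_fin_one {B : Set M} (φ : L.Formula (B ⊕ Fin 1)) : aclDim L φ ≤ 1 := by
  refine iSup₂_le fun d hd => ?_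
  obtain ⟨N, _, f, a, j, -⟩ := hd
  have := Fintype.card_le_of_embedding j
  rw [Fintype.card_fin, Fintype.card_fin] at this
  exact_mod_cast this

/-- A tuple on a curve has no two coordinates that are independent over the parameters. -/
theorem IsCurveOver.mem_modelAcl {A : Set M} {n : ℕ} {C : Set (Fin n → M)}
    (hC : IsCurveOver L A C) {a : Fin n → M} (ha : a ∈ C) (k l : Fin n)
    (hk : a k ∉ modelAcl L A) : a l ∈ modelAcl L (insert (a k) A) := by
  obtain ⟨φ, rfl, hφ⟩ := hC
  by_contra hl
  have hkl : k ≠ l := by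
    rintro rfl
    refine hl ⟨{a k}, ?_, Set.finite_singleton _, rfl⟩
    exact Set.Definable.singleton_of_mem L (Set.mem_insert _ _)
  have hj : Function.Injective ![k, l] := by
    intro p q hpq
    fin_cases p <;> fin_cases q <;> simp_all
  -- The elementary extension in the definition of dimension may be `M` itself.
  have h2 : ((2 : ℕ) : ℕ∞) ≤ aclDim L φ := by
    have himg : (ElementaryEmbedding.refl L M : M → M) '' A = A := Set.image_id A
    refine le_iSup₂_of_le 2 ⟨M, inferInstance, ElementaryEmbedding.refl L M, a, ⟨_, hj⟩, ha, ?_⟩ le_rfl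
    intro p
    fin_cases p
    · simpa [himg] using hk
    · have : {c | ∃ q < (1 : Fin 2), c = a (![k, l] q)} = {a k} := by
        ext c
        simp
      simpa [this, himg] using hl
  have := h2.trans hφ
  norm_cast at this

variable {A : Set M}

/-- Curves do not separate two pairs with the same first entry, whose second entries have the same
type and are independent from the first one. -/
theorem IsCurveOver.mem_iff_of_independent {x y y' : M} (hx : x ∉ modelAcl L A)
    (hy : y ∉ modelAcl L (insert x A)) (hy' : y' ∉ modelAcl L (insert x A))
    (htp : ∀ φ : L.Formula (A ⊕ Unit), φ.Realize (Sum.elim (fun a : A => (a : M)) fun _ => y) ↔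
      φ.Realize (Sum.elim (fun a : A => (a : M)) fun _ => y'))
    {n : ℕ} (σ : Fin n → Fin 2) {C : Set (Fin n → M)} (hC : IsCurveOver L A C) :
    ![x, y] ∘ σ ∈ C ↔ ![x, y'] ∘ σ ∈ C := by
  by_cases h0 : ∃ k, σ k = 0
  · by_cases h1 : ∃ l, σ l = 1
    · obtain ⟨k, hk⟩ := h0
      obtain ⟨l, hl⟩ := h1
      -- A point of `C` in which both entries occur would make the second algebraic over the first,
      -- so neither tuple lies in `C`.
      refine iff_of_false (fun h => hy ?_) (fun h => hy' ?_)
      · simpa [hk, hl] using hC.mem_modelAcl h k l (by simpa [hk] using hx)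
      · simpa [hk, hl] using hC.mem_modelAcl h k l (by simpa [hk] using hx)
    · have hσ : ∀ k, σ k = 0 := fun k => by
        rcases Fin.exists_fin_two.1 ⟨σ k, rfl⟩ with h | h
        · exact h
        · exact absurd ⟨k, h⟩ h1
      have e : ![x, y] ∘ σ = ![x, y'] ∘ σ := by
        funext k
        simp [hσ k]
      rw [e]
  · have hσ : ∀ k, σ k = 1 := fun k => by
      rcases Fin.exists_fin_two.1 ⟨σ k, rfl⟩ with h | h
      · exact absurd ⟨k, h⟩ h0
      · exact h
    have e : ∀ z : M, ![x, z] ∘ σ = fun _ => z := fun z => by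
      funext k
      simp [hσ k]
    rw [e, e]
    obtain ⟨φ, rfl, -⟩ := hC
    have := htp (φ.relabel (Sum.map id fun _ => ()))
    rw [Formula.realize_relabel, Formula.realize_relabel, Sum.elim_comp_map, Sum.elim_comp_map] at this
    exact this

/-- Two pairs that are not separated by curves are not separated by quantifier-free formulas. -/
theorem realize_iff_of_isQF_curveLanguage {m : ℕ} {p p' : Fin m → M}
    (hsep : ∀ (n : ℕ) (σ : Fin n → Fin m) (C : Set (Fin n → M)), IsCurveOver L A C →
      (p ∘ σ ∈ C ↔ p' ∘ σ ∈ C))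
    (heq : ∀ i j, p i = p j ↔ p' i = p' j) (ψ : (curveLanguage L A).Formula (Fin m))
    (hψ : ψ.IsQF) : ψ.Realize p ↔ ψ.Realize p' := by
  -- The language has no function symbols, so every term is a variable.
  have hterm : ∀ t : (curveLanguage L A).Term (Fin m ⊕ Fin 0), ∃ i : Fin m, ∀ q : Fin m → M,
      t.realize (Sum.elim q default) = q i := by
    rintro ((i | i) | ⟨f, -⟩)
    · exact ⟨i, fun _ => rfl⟩
    · exact i.elim0
    · exact f.elim
  choose σ hσ using hterm
  suffices h : ∀ ψ : (curveLanguage L A).BoundedFormula (Fin m) 0, ψ.IsQF →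
      (ψ.Realize p default ↔ ψ.Realize p' default) from h ψ hψ
  intro ψ hψ
  induction hψ with
  | falsum => exact Iff.rfl
  | of_isAtomic h =>
    cases h with
    | equal t₁ t₂ =>
      rw [BoundedFormula.realize_bdEqual, BoundedFormula.realize_bdEqual, hσ, hσ, hσ, hσ]
      exact heq _ _
    | rel R ts =>
      rw [BoundedFormula.realize_rel, BoundedFormula.realize_rel]
      simp only [hσ]
      exact hsep _ (fun i => σ (ts i)) R.1 R.2
  | imp _ _ ih₁ ih₂ => exact imp_congr ih₁ ih₂

theorem mem_iff_of_isBoolCombOfCylinders {m : ℕ} {p p' : Fin m → M}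
    (hsep : ∀ (n : ℕ) (σ : Fin n → Fin m) (C : Set (Fin n → M)), IsCurveOver L A C →
      (p ∘ σ ∈ C ↔ p' ∘ σ ∈ C)) {Y : Set (Fin m → M)} (hY : IsBoolCombOfCylinders L A Y) :
    p ∈ Y ↔ p' ∈ Y := by
  induction hY using BooleanSubalgebra.closure_bot_sup_induction with
  | mem Y hY =>
    obtain ⟨n, i, C, hC, rfl⟩ := hY
    exact hsep n i C hC
  | bot => exact Iff.rfl
  | sup Y _ Z _ hY hZ => exact or_congr hY hZ
  | compl Y _ hY => exact not_congr hY

end Curves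

/-! ### The symmetry exchanging the square roots of `-1`. -/

section Conjugation

open Polynomial

variable {M : Type w} [Field M] {O : ValuationSubring M}

theorem valuation_intCast_lt_one_iff (n : ℤ) :
    O.valuation (n : M) < 1 ↔ (ringChar (IsLocalRing.ResidueField O) : ℤ) ∣ n := by
  rw [← CharP.intCast_eq_zero_iff (IsLocalRing.ResidueField O), ← map_intCast (IsLocalRing.residue O),
    IsLocalRing.residue_eq_zero_iff, ValuationSubring.valuation_lt_one_iff]
  norm_cast

theorem valuation_intCast_le_one (n : ℤ) : O.valuation (n : M) ≤ 1 :=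
  (O.valuation_le_one_iff _).2 (intCast_mem O n)

theorem valuation_eq_one_of_sq_eq_neg_one {i : M} (hi : i ^ 2 = -1) : O.valuation i = 1 := by
  have : O.valuation i ^ 2 = 1 := by rw [← map_pow, hi, Valuation.map_neg, map_one]
  exact (pow_eq_one_iff_of_nonneg zero_le two_ne_zero).1 this

/-- Conjugation preserves the valuation of Gaussian integers if the residue characteristic is `0` or
`3` modulo `4`. -/
theorem valuation_add_mul_eq_sub_mul
    (hres : ringChar (IsLocalRing.ResidueField O) = 0 ∨
      ringChar (IsLocalRing.ResidueField O) % 4 = 3) {i : M} (hi : i ^ 2 = -1) (a b : ℤ) :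
    O.valuation (a + b * i) = O.valuation (a - b * i) := by
  set p := ringChar (IsLocalRing.ResidueField O) with hp
  have hvi := valuation_eq_one_of_sq_eq_neg_one (O := O) hi
  -- For prime `p` this is because `-1` is not a square modulo `p`; for `p = 0` divisibility means
  -- vanishing.
  have hdvd : ∀ a b : ℤ, (p : ℤ) ∣ a ^ 2 + b ^ 2 → (p : ℤ) ∣ a ∧ (p : ℤ) ∣ b := by
    intro a b hab
    rcases CharP.char_is_prime_or_zero (IsLocalRing.ResidueField O) p with hprime | h0
    · have : Fact p.Prime := ⟨hprime⟩
      have hp3 : p % 4 = 3 := hres.resolve_left hprime.ne_zero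
      rw [← ZMod.intCast_zmod_eq_zero_iff_dvd] at hab
      push_cast at hab
      rw [← ZMod.intCast_zmod_eq_zero_iff_dvd, ← ZMod.intCast_zmod_eq_zero_iff_dvd]
      by_cases hb : (b : ZMod p) = 0
      · rw [hb] at hab
        exact ⟨by simpa using hab, hb⟩
      · exact absurd hp3 (ZMod.mod_four_ne_three_of_sq_eq_neg_sq' hb (eq_neg_of_add_eq_zero_left hab))
    · rw [h0, Nat.cast_zero, zero_dvd_iff] at hab
      rw [h0, Nat.cast_zero, zero_dvd_iff, zero_dvd_iff]
      constructor <;> nlinarith [sq_nonneg a, sq_nonneg b]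
  -- Descent by cancelling common factors `p`. When `p` does not divide `a ^ 2 + b ^ 2`, this norm
  -- is a unit, and both of its integral factors have value one.
  induction hn : a.natAbs + b.natAbs using Nat.strong_induction_on generalizing a b with
  | _ n ih =>
  by_cases hpab : (p : ℤ) ∣ a ^ 2 + b ^ 2
  · obtain ⟨⟨a', rfl⟩, ⟨b', rfl⟩⟩ := hdvd a b hpab
    by_cases h0 : (p : ℤ) * a' = 0 ∧ (p : ℤ) * b' = 0
    · rw [h0.1, h0.2]; simp
    have hlt : a'.natAbs + b'.natAbs < n := by
      have hp0 : p ≠ 0 := by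
        intro hp0
        simp [hp0] at h0
      have hp2 : 2 ≤ p := ((CharP.char_is_prime_or_zero (IsLocalRing.ResidueField O) p).resolve_right
        hp0).two_le
      rw [Int.natAbs_mul, Int.natAbs_mul, Int.natAbs_natCast, ← mul_add] at hn
      have hpos : 0 < a'.natAbs + b'.natAbs := by
        by_contra hcon
        have h1 : a' = 0 := by omega
        have h2 : b' = 0 := by omega
        exact h0 ⟨by rw [h1, mul_zero], by rw [h2, mul_zero]⟩
      nlinarith
    have := ih _ hlt a' b' rfl
    push_cast
    rw [mul_assoc, ← mul_add, ← mul_sub, map_mul, map_mul, this]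
  · have h1 : O.valuation (a + b * i) * O.valuation (a - b * i) = 1 := by
      have e : ((a : M) + b * i) * (a - b * i) = ((a ^ 2 + b ^ 2 : ℤ) : M) := by
        push_cast
        linear_combination (-(b : M) ^ 2) * hi
      rw [← map_mul, e]
      exact le_antisymm (valuation_intCast_le_one _)
        (not_lt.1 fun hlt => hpab ((valuation_intCast_lt_one_iff _).1 hlt))
    have hbi : O.valuation (b * i) ≤ 1 := by
      rw [map_mul, hvi, mul_one]; exact valuation_intCast_le_one b
    have h2 : O.valuation (a + b * i) ≤ 1 := O.valuation.map_add_le (valuation_intCast_le_one a) hbi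
    have h3 : O.valuation (a - b * i) ≤ 1 := O.valuation.map_sub_le (valuation_intCast_le_one a) hbi
    have h4 : O.valuation (a + b * i) = 1 :=
      le_antisymm h2 (h1 ▸ mul_le_of_le_one_right' h3)
    rw [h4, one_mul] at h1
    rw [h4, h1]

/-- Points infinitesimally close to the two square roots of `-1` have the same quantifier-free
type. -/
theorem sameValues_conj_add_infinitesimal
    (hres : ringChar (IsLocalRing.ResidueField O) = 0 ∨
      ringChar (IsLocalRing.ResidueField O) % 4 = 3) {i : M} (hi : i ^ 2 = -1) {e : M}
    (he : IsInfinitesimalOver O (Subring.closure {i}) e) :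
    SameValues O (fun _ : Unit => i + e) fun _ => -i + e := by
  let f₁ : GaussianInt →+* M := Zsqrtd.lift ⟨i, by rw [← sq, hi]; norm_num⟩
  let f₂ : GaussianInt →+* M := Zsqrtd.lift ⟨-i, by rw [← sq, neg_sq, hi]; norm_num⟩
  have hf₁ : ∀ c, f₁ c = c.re + c.im * i := fun c => rfl
  have hf₂ : ∀ c, f₂ c = c.re - c.im * i := fun c => by
    rw [sub_eq_add_neg, ← mul_neg]; rfl
  have hf : ∀ c, O.valuation (f₁ c) = O.valuation (f₂ c) := fun c => by
    rw [hf₁, hf₂]; exact valuation_add_mul_eq_sub_mul hres hi _ _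
  have hmem : ∀ c, f₁ c ∈ Subring.closure {i} ∧ f₂ c ∈ Subring.closure {i} := fun c => by
    have hi' : i ∈ Subring.closure {i} := Subring.subset_closure rfl
    rw [hf₁, hf₂]
    exact ⟨add_mem (intCast_mem _ _) (mul_mem (intCast_mem _ _) hi'),
      sub_mem (intCast_mem _ _) (mul_mem (intCast_mem _ _) hi')⟩
  have hP : ∀ x ∈ pairRing (fun _ : Unit => i + e) fun _ => -i + e,
      ∃ P : GaussianInt[X], x = (P.eval₂ f₁ e, P.eval₂ f₂ e) := by
    intro x hx
    induction hx using Subring.closure_induction with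
    | mem x hx =>
      obtain ⟨_, rfl⟩ := hx
      refine ⟨C ⟨0, 1⟩ + X, ?_⟩
      simp [eval₂_add, hf₁, hf₂]
    | zero => exact ⟨0, by rw [eval₂_zero, eval₂_zero]; rfl⟩
    | one => exact ⟨1, by rw [eval₂_one, eval₂_one]; rfl⟩
    | add x y _ _ hx hy =>
      obtain ⟨P, rfl⟩ := hx
      obtain ⟨Q, rfl⟩ := hy
      exact ⟨P + Q, by simp [eval₂_add]⟩
    | neg x _ hx =>
      obtain ⟨P, rfl⟩ := hx
      exact ⟨-P, by simp [eval₂_neg]⟩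
    | mul x y _ _ hx hy =>
      obtain ⟨P, rfl⟩ := hx
      obtain ⟨Q, rfl⟩ := hy
      exact ⟨P * Q, by simp [eval₂_mul]⟩
  have hval : ∀ P : GaussianInt[X], O.valuation (P.eval₂ f₁ e) = O.valuation (P.eval₂ f₂ e) := by
    intro P
    -- Either a factor of the variable splits off, or a constant term is present and dominates at
    -- `e`.
    induction P using Polynomial.recOnHorner with
    | M0 => simp
    | MC P a hP0 ha ih =>
      -- The maps need not be injective: `M` may have positive characteristic.
      by_cases h0 : f₁ a = 0
      · have h0' : f₂ a = 0 := by
          rw [← map_eq_zero O.valuation, ← hf, h0, map_zero]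
        rw [eval₂_add, eval₂_add, eval₂_C, eval₂_C, h0, h0', add_zero, add_zero, ih]
      · have h0' : f₂ a ≠ 0 := by
          rwa [← O.valuation.ne_zero_iff, ← hf, O.valuation.ne_zero_iff]
        have hc : ∀ f : GaussianInt →+* M, ((P + C a).map f).coeff 0 = f a := fun f => by
          simp [hP0]
        rw [← eval_map, ← eval_map, he.valuation_eval (fun k => ?_) (by rw [hc]; exact h0),
          he.valuation_eval (fun k => ?_) (by rw [hc]; exact h0'), hc, hc, hf]
        · rw [coeff_map]; exact (hmem _).2
        · rw [coeff_map]; exact (hmem _).1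
    | MX P _ ih => rw [eval₂_mul_X, eval₂_mul_X, map_mul, map_mul, ih]
  intro x hx y hy
  obtain ⟨P, rfl⟩ := hP x hx
  obtain ⟨Q, rfl⟩ := hP y hy
  rw [hval P, hval Q]

end Conjugation

/-! ### Residue classes as curves, and the inseparable pairs. -/

section Cylinders

variable {M : Type w} [Field M] {O : ValuationSubring M} [valuedFieldLanguage.Structure M]

/-- The formula `z ^ 2 + 1 = 0`. -/
def sqEqNegOne : valuedFieldLanguage.Formula Unit :=
  (addTerm (mulTerm (Term.var ()) (Term.var ())) oneTerm).equal zeroTerm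

/-- The formula saying that a variable lies in the maximal ideal after subtracting another one. -/
def subMemMaxIdeal {α : Type*} (i j : α) : valuedFieldLanguage.Formula α :=
  valuationLT (addTerm (Term.var i) (negTerm (Term.var j))) oneTerm

namespace InterpretsValuedField

theorem realize_sqEqNegOne (hM : InterpretsValuedField O) (x : Unit → M) :
    sqEqNegOne.Realize x ↔ x () ^ 2 + 1 = 0 := by
  rw [sqEqNegOne, Formula.realize_equal, hM.realize_add, hM.realize_mul, hM.realize_one,
    hM.realize_zero, sq]
  exact Iff.rfl

theorem realize_subMemMaxIdeal (hM : InterpretsValuedField O) {α : Type*} (i j : α) (x : α → M) :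
    (subMemMaxIdeal i j).Realize x ↔ O.valuation (x i - x j) < 1 := by
  rw [subMemMaxIdeal, hM.realize_valuationLT, hM.realize_add, hM.realize_neg, hM.realize_one,
    map_one, sub_eq_add_neg]
  exact Iff.rfl

theorem mem_modelAcl_of_sq_eq_neg_one (hM : InterpretsValuedField O) {i : M} (hi : i ^ 2 = -1)
    (A : Set M) : i ∈ modelAcl valuedFieldLanguage A := by
  refine ⟨{z | z ^ 2 + 1 = 0}, ?_, ?_, ?_⟩
  · refine Set.Definable.mono (Set.empty_definable_iff.2 ⟨sqEqNegOne.relabel fun _ => 0, ?_⟩)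
      (Set.empty_subset A)
    ext x
    rw [Set.mem_ofPred_eq, Set.mem_ofPred_eq, Set.mem_ofPred_eq, Formula.realize_relabel,
      hM.realize_sqEqNegOne]
    exact Iff.rfl
  · refine Set.Finite.subset (Set.toFinite {i, -i}) fun z hz => ?_
    rw [Set.mem_ofPred_eq] at hz
    exact sq_eq_sq_iff_eq_or_eq_neg.1 (by linear_combination hz - hi)
  · rw [Set.mem_ofPred_eq, hi, neg_add_cancel]

/-- A residue class of a square root of `-1` is a curve over the algebraic closure of `∅`. -/
theorem isCurveBasedCylinder_residueClass (hM : InterpretsValuedField O) {m : ℕ} (k : Fin m) {i : M}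
    (hi : i ^ 2 = -1) : IsCurveBasedCylinder valuedFieldLanguage
      (modelAcl valuedFieldLanguage (∅ : Set M)) {p : Fin m → M | O.valuation (p k - i) < 1} := by
  refine ⟨1, ⟨⟨fun _ => k, fun _ _ _ => Subsingleton.elim _ _⟩, ?_⟩,
    {x | O.valuation (x 0 - i) < 1}, ⟨subMemMaxIdeal (Sum.inr 0)
      (Sum.inl ⟨i, hM.mem_modelAcl_of_sq_eq_neg_one hi ∅⟩), ?_, aclDim_le_one_of_fin_one _⟩, rfl⟩
  · intro a b
    rw [Subsingleton.elim a b]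
    simp
  · ext x
    rw [Set.mem_ofPred_eq, Set.mem_ofPred_eq, hM.realize_subMemMaxIdeal]
    exact Iff.rfl

/-- The pairs of a square root `z` of `-1` and a point in its residue class form a curve over `∅`. -/
theorem isCurveOver_residueClass (hM : InterpretsValuedField O) (hi : ∃ i : M, i ^ 2 = -1) :
    IsCurveOver valuedFieldLanguage (∅ : Set M)
      {x : Fin 2 → M | x 1 ^ 2 + 1 = 0 ∧ O.valuation (x 0 - x 1) < 1} := by
  refine ⟨sqEqNegOne.relabel (fun _ => Sum.inr 1) ⊓ subMemMaxIdeal (Sum.inr 0) (Sum.inr 1), ?_, ?_⟩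
  · ext x
    rw [Set.mem_ofPred_eq, Set.mem_ofPred_eq, Formula.realize_inf, Formula.realize_relabel,
      hM.realize_sqEqNegOne, hM.realize_subMemMaxIdeal]
    exact Iff.rfl
  · refine iSup₂_le fun d hd => ?_
    obtain ⟨N, _, f, a, j, ha, hj⟩ := hd
    rw [Formula.realize_inf, Formula.realize_relabel] at ha
    have ha1 : sqEqNegOne.Realize fun _ => a 1 := ha.1
    obtain ⟨i, hi⟩ := hi
    -- `θ` says that every square root of `-1` is one of two given elements. Transferred along `f`,
    -- it shows that the second coordinate is algebraic over `∅` in the extension too.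
    let θ : valuedFieldLanguage.Formula (Fin 2) := Formula.iAlls Unit
      ((sqEqNegOne.relabel Sum.inr).imp
        (((Term.var (Sum.inr ()) : valuedFieldLanguage.Term (Fin 2 ⊕ Unit)).equal
            (Term.var (Sum.inl 0))) ⊔
          (Term.var (Sum.inr ()) : valuedFieldLanguage.Term (Fin 2 ⊕ Unit)).equal
            (Term.var (Sum.inl 1))))
    have hθ : ∀ {K : Type w} [valuedFieldLanguage.Structure K] (c : Fin 2 → K), θ.Realize c ↔
        ∀ z : Unit → K, sqEqNegOne.Realize z → z () = c 0 ∨ z () = c 1 := by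
      intro K _ c
      simp only [θ]
      rw [Formula.realize_iAlls]
      refine forall_congr' fun z => ?_
      rw [Formula.realize_imp, Formula.realize_relabel, Sum.elim_comp_inr, Formula.realize_sup,
        Formula.realize_equal, Formula.realize_equal]
      exact Iff.rfl
    have hθN : θ.Realize (f ∘ ![i, -i]) := by
      rw [f.map_formula, hθ]
      intro z hz
      rw [hM.realize_sqEqNegOne] at hz
      exact (sq_eq_sq_iff_eq_or_eq_neg (b := i)).1 (by linear_combination hz - hi)
    rw [hθ] at hθN
    have hacl : ∀ B : Set N, a 1 ∈ modelAcl valuedFieldLanguage B := by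
      intro B
      refine ⟨{z | sqEqNegOne.Realize fun _ => z}, ?_, ?_, ha1⟩
      · refine Set.Definable.mono (Set.empty_definable_iff.2 ⟨sqEqNegOne.relabel fun _ => 0, ?_⟩)
          (Set.empty_subset B)
        ext x
        rw [Set.mem_ofPred_eq, Set.mem_ofPred_eq, Set.mem_ofPred_eq, Formula.realize_relabel]
        exact Iff.rfl
      · exact Set.Finite.subset (Set.toFinite {f i, f (-i)}) fun z hz => hθN (fun _ => z) hz
    have hd : d ≤ 1 := by
      have hne : ∀ k, j k ≠ 1 := fun k hk => hj k (hk ▸ hacl _)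
      have h0 : ∀ k, j k = 0 := fun k => by
        rcases Fin.exists_fin_two.1 ⟨j k, rfl⟩ with h | h
        · exact h
        · exact absurd h (hne k)
      by_contra! hlt
      have := j.injective ((h0 ⟨0, by omega⟩).trans (h0 ⟨1, hlt⟩).symm)
      simp at this
    exact_mod_cast hd

variable [IsAlgClosed M]

/-- Two pairs that are separated by the formula `ρ`, but not by curves over `∅`. -/
theorem exists_pairs_not_separated_by_curves (hM : InterpretsValuedField O) (hO : O ≠ ⊤)
    (hsat : IsSaturatedStructure valuedFieldLanguage M ℵ₀)
    (hres : ringChar (IsLocalRing.ResidueField O) = 0 ∨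
      ringChar (IsLocalRing.ResidueField O) % 4 = 3) {i : M} (hi : i ^ 2 = -1) :
    ∃ x y y' : M, O.valuation (x - i) < 1 ∧ O.valuation (y - i) < 1 ∧ O.valuation (y' + i) < 1 ∧
      x ≠ y ∧ x ≠ y' ∧ ∀ (n : ℕ) (σ : Fin n → Fin 2) (C : Set (Fin n → M)),
        IsCurveOver valuedFieldLanguage (∅ : Set M) C → (![x, y] ∘ σ ∈ C ↔ ![x, y'] ∘ σ ∈ C) := by
  -- Choosing `e₂` infinitesimal over both `i` and `e₁` makes `i + e₂` and `-i + e₂` independent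
  -- from `i + e₁`.
  obtain ⟨e₁, he₁0, he₁⟩ := hM.exists_infinitesimal hO hsat (Set.finite_singleton i)
  obtain ⟨e₂, he₂0, he₂⟩ := hM.exists_infinitesimal hO hsat ((Set.finite_singleton i).insert e₁)
  have ht₁ := he₁.transcendental he₁0
  have ht₂ := he₂.transcendental he₂0
  have hmem₁ : i ∈ Algebra.adjoin ℤ ({i} : Set M) := Algebra.subset_adjoin rfl
  have hmem₂ : i ∈ Algebra.adjoin ℤ ({e₁, i} : Set M) := Algebra.subset_adjoin (by simp)
  have hmem₃ : e₁ ∈ Algebra.adjoin ℤ ({e₁, i} : Set M) := Algebra.subset_adjoin (by simp)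
  have halg : ∀ {B : Set M} {z : M}, z ∈ Algebra.adjoin ℤ B → IsAlgebraic (Algebra.adjoin ℤ B) z :=
    fun {B z} hz => isAlgebraic_algebraMap (⟨z, hz⟩ : Algebra.adjoin ℤ B)
  have hx : i + e₁ ∉ modelAcl valuedFieldLanguage (∅ : Set M) := by
    rw [hM.mem_modelAcl_iff hO hsat]
    intro h
    have h1 : IsAlgebraic (Algebra.adjoin ℤ ({i} : Set M)) (i + e₁) :=
      IsAlgebraic.adjoin_of_forall_isAlgebraic (fun x hx => absurd hx.1 (Set.notMem_empty x)) h
    have h2 := h1.sub (halg hmem₁)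
    rw [add_sub_cancel_left] at h2
    exact ht₁ h2
  have hy : ∀ j : M, j ∈ Algebra.adjoin ℤ ({e₁, i} : Set M) →
      j + e₂ ∉ modelAcl valuedFieldLanguage (insert (i + e₁) (∅ : Set M)) := by
    intro j hj
    rw [hM.mem_modelAcl_iff hO hsat]
    intro h
    have h1 : IsAlgebraic (Algebra.adjoin ℤ ({e₁, i} : Set M)) (j + e₂) := by
      refine IsAlgebraic.adjoin_of_forall_isAlgebraic (fun x hx => ?_) h
      have hx' : x = i + e₁ := by simpa using hx.1
      rw [hx']
      exact halg (add_mem hmem₂ hmem₃)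
    have h2 := h1.sub (halg hj)
    rw [add_sub_cancel_left] at h2
    exact ht₂ h2
  have hself : ∀ x : M, x ∈ modelAcl valuedFieldLanguage (insert x (∅ : Set M)) := fun x =>
    ⟨{x}, Set.Definable.singleton_of_mem _ (Set.mem_insert _ _), Set.finite_singleton _, rfl⟩
  have hy₁ := hy i hmem₂
  have hy₂ := hy (-i) (neg_mem hmem₂)
  refine ⟨i + e₁, i + e₂, -i + e₂, ?_, ?_, ?_, ?_, ?_, fun n σ C hC =>
    hC.mem_iff_of_independent hx hy₁ hy₂ (fun φ => ?_) σ⟩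
  · rw [add_sub_cancel_left]; exact he₁.valuation_lt_one
  · rw [add_sub_cancel_left]; exact he₂.valuation_lt_one
  · rw [neg_add_cancel_comm]; exact he₂.valuation_lt_one
  · intro h
    exact hy₁ (h ▸ hself _)
  · intro h
    exact hy₂ (h ▸ hself _)
  · refine hM.realize_formula_iff hO hsat φ ?_
    have hs := (sameValues_conj_add_infinitesimal hres hi (he₂.mono
      (Subring.closure_mono (Set.subset_insert _ _)))).comp
      (fun _ : (∅ : Set M) ⊕ Unit => ())
    have e : ∀ z : M, ((fun _ => z) : Unit → M) ∘ (fun _ : (∅ : Set M) ⊕ Unit => ()) =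
        Sum.elim (fun a : (∅ : Set M) => (a : M)) fun _ => z := by
      intro z
      funext k
      rcases k with k | k
      · exact k.2.elim
      · rfl
    rw [e, e] at hs
    exact hs

end InterpretsValuedField

end Cylinders

/-! ### Assembly of the three claims. -/

theorem mainTheorem7 {M : Type w} [Field M] [IsAlgClosed M] (𝒪 : ValuationSubring M)
    (hnontriv : 𝒪 ≠ ⊤) (hchar : ringChar M ≠ 2) :
    letI : valuedFieldLanguage.Structure M := valuedFieldStructure 𝒪
    IsSaturatedStructure valuedFieldLanguage M ℵ₀ →
      -- the structure is geometric
      IsGeometricStructure valuedFieldLanguage M ∧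
      -- the formula is equivalent to the displayed quantifier-free one over a square root of `-1`
      (∀ i : M, i ^ 2 = -1 → ∀ p : Fin 2 → M, rhoFormula.Realize p ↔
        (p 0 - i ∈ 𝒪.nonunits ∧ p 1 - i ∈ 𝒪.nonunits) ∨
        (p 0 + i ∈ 𝒪.nonunits ∧ p 1 + i ∈ 𝒪.nonunits)) ∧
      -- it defines a boolean combination of `acl(∅)`-definable curve-based cylinders
      IsBoolCombOfCylinders valuedFieldLanguage
        (modelAcl valuedFieldLanguage (∅ : Set M)) {p : Fin 2 → M | rhoFormula.Realize p} ∧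
      -- if the residue characteristic is `0` or `≡ 3 mod 4`, then it does not define a boolean
      -- combination of `∅`-definable ones, and adding predicates for the `∅`-definable curves
      -- only gives a structure without quantifier elimination
      (ringChar (IsLocalRing.ResidueField 𝒪) = 0 ∨
          ringChar (IsLocalRing.ResidueField 𝒪) % 4 = 3 →
        ¬ IsBoolCombOfCylinders valuedFieldLanguage (∅ : Set M)
            {p : Fin 2 → M | rhoFormula.Realize p} ∧
        ¬ HasQuantifierElimination (curveLanguage valuedFieldLanguage (∅ : Set M)) M) := by
  let : valuedFieldLanguage.Structure M := valuedFieldStructure 𝒪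
  intro hsat
  have hM : InterpretsValuedField 𝒪 := interpretsValuedField_valuedFieldStructure 𝒪
  have hsq : ∀ i z : M, i ^ 2 = -1 → z ^ 2 + 1 = 0 → z = i ∨ z = -i := fun i z hi hz =>
    sq_eq_sq_iff_eq_or_eq_neg.1 (by linear_combination hz - hi)
  have hrho : ∀ i : M, i ^ 2 = -1 → ∀ p : Fin 2 → M, rhoFormula.Realize p ↔
      (p 0 - i ∈ 𝒪.nonunits ∧ p 1 - i ∈ 𝒪.nonunits) ∨
      (p 0 + i ∈ 𝒪.nonunits ∧ p 1 + i ∈ 𝒪.nonunits) := by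
    intro i hi p
    refine (realize_rhoFormula 𝒪 p).trans ⟨?_, ?_⟩
    · rintro ⟨z, hz, h0, h1⟩
      rcases hsq i z hi hz with rfl | rfl
      · exact Or.inl ⟨h0, h1⟩
      · exact Or.inr ⟨by rwa [sub_neg_eq_add] at h0, by rwa [sub_neg_eq_add] at h1⟩
    · rintro (⟨h0, h1⟩ | ⟨h0, h1⟩)
      · exact ⟨i, by rw [hi, neg_add_cancel], h0, h1⟩
      · exact ⟨-i, by rw [neg_sq, hi, neg_add_cancel], by rwa [sub_neg_eq_add],
          by rwa [sub_neg_eq_add]⟩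
  obtain ⟨i, hi⟩ := IsAlgClosed.exists_pow_nat_eq (-1 : M) two_pos
  have hi' : (-i) ^ 2 = -1 := by rw [neg_sq, hi]
  refine ⟨hM.isGeometricStructure hnontriv hsat, hrho, ?_, fun hres => ?_⟩
  · have hmem : ∀ (k : Fin 2) (j : M), j ^ 2 = -1 → {p : Fin 2 → M | 𝒪.valuation (p k - j) < 1} ∈
        BooleanSubalgebra.closure {Z : Set (Fin 2 → M) | IsCurveBasedCylinder valuedFieldLanguage
          (modelAcl valuedFieldLanguage (∅ : Set M)) Z} := fun k j hj =>
      BooleanSubalgebra.subset_closure (hM.isCurveBasedCylinder_residueClass k hj)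
    have hset : {p : Fin 2 → M | rhoFormula.Realize p} =
        ({p : Fin 2 → M | 𝒪.valuation (p 0 - i) < 1} ⊓ {p | 𝒪.valuation (p 1 - i) < 1}) ⊔
        ({p | 𝒪.valuation (p 0 - -i) < 1} ⊓ {p | 𝒪.valuation (p 1 - -i) < 1}) := by
      ext p
      refine (hrho i hi p).trans ?_
      rw [← sub_neg_eq_add, ← sub_neg_eq_add, 𝒪.mem_nonunits_iff, 𝒪.mem_nonunits_iff,
        𝒪.mem_nonunits_iff, 𝒪.mem_nonunits_iff]
      exact Iff.rfl
    rw [IsBoolCombOfCylinders, hset]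
    exact BooleanSubalgebra.sup_mem
      (BooleanSubalgebra.inf_mem (hmem 0 i hi) (hmem 1 i hi))
      (BooleanSubalgebra.inf_mem (hmem 0 (-i) hi') (hmem 1 (-i) hi'))
  · obtain ⟨x, y, y', hx, hy, hy', hxy, hxy', hsep⟩ :=
      hM.exists_pairs_not_separated_by_curves hnontriv hsat hres hi
    have hpos : rhoFormula.Realize ![x, y] :=
      (hrho i hi _).2 (Or.inl ⟨𝒪.mem_nonunits_iff.2 hx, 𝒪.mem_nonunits_iff.2 hy⟩)
    -- The residue characteristic is `0` or odd, so the residue classes of `i` and `-i` are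
    -- disjoint.
    have h2i : ¬ 𝒪.valuation (2 * i) < 1 := by
      rw [map_mul, valuation_eq_one_of_sq_eq_neg_one hi, mul_one]
      intro h2
      have h2' := (valuation_intCast_lt_one_iff (O := 𝒪) 2).1 (by exact_mod_cast h2)
      have h3 : ringChar (IsLocalRing.ResidueField 𝒪) ∣ 2 := by exact_mod_cast h2'
      have h4 := Nat.le_of_dvd two_pos h3
      rcases hres with h0 | h0
      · rw [h0] at h3
        simp at h3
      · omega
    have hneg : ¬ rhoFormula.Realize ![x, y'] := by
      rw [hrho i hi]
      rintro (⟨-, h⟩ | ⟨h, -⟩)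
      · refine h2i ?_
        have h' : 𝒪.valuation (y' - i) < 1 := h
        have := 𝒪.valuation.map_sub_lt hy' h'
        rwa [show y' + i - (y' - i) = 2 * i by ring] at this
      · refine h2i ?_
        have h' : 𝒪.valuation (x + i) < 1 := h
        have := 𝒪.valuation.map_sub_lt h' hx
        rwa [show x + i - (x - i) = 2 * i by ring] at this
    refine ⟨fun hB => hneg ((mem_iff_of_isBoolCombOfCylinders hsep hB).1 hpos), fun hQE => hneg ?_⟩
    -- `R` relates a point to a square root of `-1` in its residue class; two points satisfy `ρ`
    -- when they share such a root.
    let R : (curveLanguage valuedFieldLanguage (∅ : Set M)).Relations 2 :=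
      ⟨_, hM.isCurveOver_residueClass ⟨i, hi⟩⟩
    let φ : (curveLanguage valuedFieldLanguage (∅ : Set M)).Formula (Fin 2) :=
      BoundedFormula.ex (n := 0)
        (BoundedFormula.rel R ![Term.var (Sum.inl 0), Term.var (Sum.inr 0)] ⊓
          BoundedFormula.rel R ![Term.var (Sum.inl 1), Term.var (Sum.inr 0)])
    have hφ : ∀ p : Fin 2 → M, φ.Realize p ↔ rhoFormula.Realize p := by
      intro p
      refine Iff.trans ?_ (realize_rhoFormula 𝒪 p).symm
      simp only [φ, Formula.Realize, BoundedFormula.realize_ex, BoundedFormula.realize_inf]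
      refine exists_congr fun z => ?_
      rw [𝒪.mem_nonunits_iff, 𝒪.mem_nonunits_iff]
      exact ⟨fun ⟨h0, h1⟩ => ⟨h0.1, h0.2, h1.2⟩, fun ⟨h, h0, h1⟩ => ⟨⟨h, h0⟩, ⟨h, h1⟩⟩⟩
    obtain ⟨ψ, hψ, hφψ⟩ := hQE 2 φ
    rw [← hφ, hφψ]
    -- Quantifier-free formulas also contain equalities, so the pairs must have the same equality
    -- pattern.
    have heq : ∀ a b : Fin 2, (![x, y] a = ![x, y] b) ↔ (![x, y'] a = ![x, y'] b) := by
      intro a b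
      fin_cases a <;> fin_cases b <;> simp [hxy, hxy', hxy.symm, hxy'.symm]
    exact (realize_iff_of_isQF_curveLanguage hsep heq ψ hψ).1 ((hφψ _).1 ((hφ _).2 hpos))
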